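/- **Setting.** Write $I=[0,1]$. Let $\mathcal K^*\in\mathbb R$, let $\rho_1,\rho_2:\mathbb R\to\mathbb R$ be weight functions, and let $U,f:I\times I\to\mathbb R$ satisfy, for all $(x,t)\in I\times I$, $$\int_0^1\rho_1(\alpha)\,\partial_t^{\alpha}U\,d\alpha+U=\mathcal K^*\int_1^2\rho_2(\beta)\,\partial_x^{\beta}U\,d\beta+J+f,\qquad J(x,t)=\int_0^t(t-\xi)^{-1/2}\,\partial_x^2U(x,\xi)\,d\xi ,$$ where $\partial_t^\alpha,\partial_x^\beta$ are Caputo derivatives with base point $0$: for $n-1<\gamma<n$, $D^\gamma u(s)=\frac1{\Gamma(n-\gamma)}\int_0^s(s-\tau)^{n-1-\gamma}u^{(n)}(\tau)\,d\tau$, and $D^nu=u^{(n)}$. Assume that $U$ is twice differentiable in $x$, that $f$, $U$, $\partial_tU$, $\partial_x^2U$ are continuous on $I\times I$ and have mixed derivatives $\partial_x^2\partial_t^2$ there (each function being twice differentiable in $t$, and its second $t$-derivative twice differentiable in $x$, one-sidedly at the boundary), bounded in absolute value by $\mathcal B,\mathcal B_0,\mathcal B_1,\mathcal B_2$ respectively.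 Put $\mathcal K=\max\{\mathcal B,\mathcal B_0,\mathcal B_1,\mathcal B_2\}$. *Wavelets.* For $R\ge1$, $1\le h\le 2^{R-1}$, $g\ge0$ let $\Psi^R_{h,g}(s)=\sqrt{g+\tfrac12}\,2^{R/2}\,p_g(2^Rs-2h+1)$ for $\frac{h-1}{2^{R-1}}\le s\le\frac h{2^{R-1}}$ and $0$ otherwise, with $p_g$ the Legendre polynomial of degree $g$. For $R,R',\Lambda,\Lambda'\ge1$ let $(H)_N$ be the truncated wavelet expansion of $H$, that is the sum over $h\le2^{R-1}$, $g<\Lambda$, $h'\le2^{R'-1}$, $g'<\Lambda'$ of $\langle H,\Psi^R_{h,g}\otimes\Psi^{R'}_{h',g'}\rangle_{L^2(I\times I)}\,\Psi^R_{h,g}(x)\Psi^{R'}_{h',g'}(t)$, and let $$S=\sum_{h>2^{R-1}}\ \sum_{g\ge\Lambda}\ \sum_{h'>2^{R'-1}}\ \sum_{g'\ge\Lambda'}\frac1{256\,(hh')^5(2g-3)^4(2g'-3)^4}.$$ *Quadrature.* For $P,P^*\ge1$ let $w_s,\sigma_s$ ($1\le s\le P$) be the weights and nodes of $P$-point Legendre–Gauss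 quadrature on $(0,1)$, and $w_r^*,\sigma_r^*$ ($1\le r\le P^*$) those of $P^*$-point Legendre–Gauss quadrature on $(1,2)$; on $(a,b)$ the root $\tau$ of the Legendre polynomial $p_n$ gives the weight $(b-a)/((1-\tau^2)p_n'(\tau)^2)$ and the node $\frac{b-a}2\tau+\frac{a+b}2$. Put $M_1=\max_s|w_s|$, $M_2=\max_s|\rho_1(\sigma_s)|$, $M_3=\max_r|w^*_r|$, $M_4=\max_r|\rho_2(\sigma^*_r)|$. Let $H_1(x,t,\alpha)=\rho_1(\alpha)\partial_t^\alpha U(x,t)$ and $H_2(x,t,\beta)=\rho_2(\beta)\partial_x^\beta U(x,t)$. The residual is $$\mathrm{Res}_N(U)=\sum_{s=1}^Pw_s\rho_1(\sigma_s)\big(\partial_t^{\sigma_s}U\big)_N+(U)_N-\mathcal K^*\sum_{r=1}^{P^*}w^*_r\rho_2(\sigma^*_r)\big(\partial_x^{\sigma^*_r}U\big)_N-(J)_N-(f)_N .$$ **Claim.** (a) Let $P,P^*\ge1$ be such that $H_1(x,t,\cdot)\in C^{2P}((0,1))$ and $H_2(x,t,\cdot)\in C^{2P^*}((1,2))$ for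 all $(x,t)\in I\times I$, and $$C_1=\sup_{x,t\in I,\,0<\alpha<1}|\partial_\alpha^{2P}H_1(x,t,\alpha)|<\infty,\qquad C_2=\sup_{x,t\in I,\,1<\beta<2}|\partial_\beta^{2P^*}H_2(x,t,\beta)|<\infty .$$ Then for all $R,R',\Lambda,\Lambda'\ge1$, $\alpha\in(0,1)$ and $\beta\in(1,2)$, $$\|\mathrm{Res}_N(U)\|_{L^2(I\times I)}\le\frac{C_1\pi}{4^P}+|\mathcal K^*|\frac{C_2\pi}{4^{P^*}}+3\mathcal K\Big[\frac{P M_1M_2}{\Gamma(2-\alpha)}+1+|\mathcal K^*|\frac{2P^*M_3M_4}{\Gamma(3-\beta)}+3\Big]\,S^{1/2}.$$ (b) $S\to0$ as $R,R',\Lambda,\Lambda'\to\infty$. (c) If the regularity assumptions of (a) hold for all $P,P^*\ge1$, then $\|\mathrm{Res}_N(U)\|_{L^2(I\times I)}\to0$ as $P,P^*,R,R',\Lambda,\Lambda'\to\infty$ jointly. -/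

import Mathlib

open Filter Topology Polynomial

noncomputable section

namespace DistributedOrder

/-! ### Partial derivatives and regularity on the unit square -/

/-- The unit interval `[0, 1]`. -/
abbrev I01 : Set ℝ := Set.Icc 0 1

/-- `n`-th partial derivative in the first (space) variable on `[0,1] × [0,1]`,
one-sided at the end points. -/
def dX (n : ℕ) (H : ℝ → ℝ → ℝ) (x t : ℝ) : ℝ :=
  iteratedDerivWithin n (fun s => H s t) I01 x

/-- `n`-th partial derivative in the second (time) variable on `[0,1] × [0,1]`,
one-sided at the end points. -/
def dT (n : ℕ) (H : ℝ → ℝ → ℝ) (x t : ℝ) : ℝ :=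
  iteratedDerivWithin n (fun s => H x s) I01 t

/-- `u` is twice differentiable on `[0, 1]` (one-sided at the end points). -/
def TwiceDiff (u : ℝ → ℝ) : Prop :=
  DifferentiableOn ℝ u I01 ∧ DifferentiableOn ℝ (derivWithin u I01) I01

/-- `H` is continuous on the unit square, the mixed derivative `∂⁴H/∂x²∂t²` exists there, and it
is bounded by `B` in absolute value. -/
structure BoundedMixed (H : ℝ → ℝ → ℝ) (B : ℝ) : Prop where
  continuousOn : ContinuousOn (fun p : ℝ × ℝ => H p.1 p.2) (I01 ×ˢ I01)
  diff_t : ∀ x ∈ I01, TwiceDiff (fun t => H x t)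
  diff_x : ∀ t ∈ I01, TwiceDiff (fun x => dT 2 H x t)
  bound : ∀ x ∈ I01, ∀ t ∈ I01, |dX 2 (dT 2 H) x t| ≤ B

/-! ### The Caputo derivative and the weakly singular integral -/

/-- Caputo derivative of order `α` (with base point `0`) of a function on `[0, 1]`, where
`n = ⌈α⌉`: the `n`-th derivative if `α = n`, and
`1/Γ(n-α) ∫₀ᵗ (t-τ)^(n-1-α) u⁽ⁿ⁾(τ) dτ` if `n - 1 < α < n`. -/
def caputo (α : ℝ) (u : ℝ → ℝ) (t : ℝ) : ℝ :=
  open Classical in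
  if α = (⌈α⌉₊ : ℝ) then iteratedDerivWithin ⌈α⌉₊ u I01 t
  else 1 / Real.Gamma (⌈α⌉₊ - α) *
    ∫ τ in (0 : ℝ)..t, (t - τ) ^ ((⌈α⌉₊ : ℝ) - 1 - α) * iteratedDerivWithin ⌈α⌉₊ u I01 τ

/-- `∂^α U / ∂t^α`. -/
def caputoT (α : ℝ) (U : ℝ → ℝ → ℝ) (x t : ℝ) : ℝ := caputo α (fun s => U x s) t

/-- `∂^β U / ∂x^β`. -/
def caputoX (β : ℝ) (U : ℝ → ℝ → ℝ) (x t : ℝ) : ℝ := caputo β (fun s => U s t) x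

/-- `J(x,t) = ∫₀ᵗ (t-ξ)^(-1/2) ∂²U/∂x² (x,ξ) dξ`. -/
def singularIntegral (U : ℝ → ℝ → ℝ) (x t : ℝ) : ℝ :=
  ∫ ξ in (0 : ℝ)..t, (t - ξ) ^ (-(1 / 2) : ℝ) * dX 2 U x ξ

/-- `H₁(x,t,α) = ρ(α) ∂^α U/∂t^α (x,t)`. -/
def H₁ (ρ : ℝ → ℝ) (U : ℝ → ℝ → ℝ) (x t α : ℝ) : ℝ := ρ α * caputoT α U x t

/-- `H₂(x,t,β) = ρ(β) ∂^β U/∂x^β (x,t)`. -/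
def H₂ (ρ : ℝ → ℝ) (U : ℝ → ℝ → ℝ) (x t β : ℝ) : ℝ := ρ β * caputoX β U x t

/-- The operator `L₁(U)`: left side minus right side of the distributed-order equation. -/
def L₁ (ρ₁ ρ₂ : ℝ → ℝ) (κ : ℝ) (f U : ℝ → ℝ → ℝ) (x t : ℝ) : ℝ :=
  (∫ α in (0 : ℝ)..1, H₁ ρ₁ U x t α) + U x t - κ * (∫ β in (1 : ℝ)..2, H₂ ρ₂ U x t β)
    - singularIntegral U x t - f x t

/-! ### Legendre polynomials, Legendre wavelets, truncated wavelet expansions -/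

/-- The Legendre polynomial of degree `n` on `[-1, 1]`, by Rodrigues' formula. -/
def legendre (n : ℕ) : ℝ[X] :=
  C ((2 ^ n * (n.factorial : ℝ))⁻¹) * derivative^[n] ((X ^ 2 - 1) ^ n)

/-- The Legendre wavelet `Ψ_{h,g}` of resolution level `R` on `[0, 1]`. -/
def wavelet (R h g : ℕ) (t : ℝ) : ℝ :=
  open Classical in
  if ((h : ℝ) - 1) / 2 ^ (R - 1) ≤ t ∧ t ≤ (h : ℝ) / 2 ^ (R - 1) then
    √((g : ℝ) + 1 / 2) * (2 : ℝ) ^ ((R : ℝ) / 2) * (legendre g).eval (2 ^ R * t - 2 * h + 1)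
  else 0

/-- The wavelet coefficient `⟨H, Ψ_{h,g} ⊗ Ψ_{h',g'}⟩` in `L²([0,1]²)`. -/
def waveletCoeff (R R' : ℕ) (H : ℝ → ℝ → ℝ) (h g h' g' : ℕ) : ℝ :=
  ∫ x in (0 : ℝ)..1, ∫ t in (0 : ℝ)..1, H x t * (wavelet R h g x * wavelet R' h' g' t)

/-- The truncated wavelet expansion `(H)_N`, with `h ≤ 2^(R-1)`, `g < Λ`, `h' ≤ 2^(R'-1)`,
`g' < Λ'`. -/
def trunc (R R' Λ Λ' : ℕ) (H : ℝ → ℝ → ℝ) (x t : ℝ) : ℝ :=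
  ∑ h ∈ Finset.Icc 1 (2 ^ (R - 1)), ∑ g ∈ Finset.range Λ,
    ∑ h' ∈ Finset.Icc 1 (2 ^ (R' - 1)), ∑ g' ∈ Finset.range Λ',
      waveletCoeff R R' H h g h' g' * (wavelet R h g x * wavelet R' h' g' t)

/-- The wavelet tail sum
`∑_{h>2^(R-1)} ∑_{g≥Λ} ∑_{h'>2^(R'-1)} ∑_{g'≥Λ'} 1/(256 (hh')⁵ (2g-3)⁴ (2g'-3)⁴)`. -/
def tailSum (R R' Λ Λ' : ℕ) : ℝ :=
  ∑' (i : ℕ) (j : ℕ) (i' : ℕ) (j' : ℕ),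
    1 / (256 * (((2 ^ (R - 1) + 1 + i : ℕ) : ℝ) * ((2 ^ (R' - 1) + 1 + i' : ℕ) : ℝ)) ^ 5
      * (2 * ((Λ + j : ℕ) : ℝ) - 3) ^ 4 * (2 * ((Λ' + j' : ℕ) : ℝ) - 3) ^ 4)

/-! ### Legendre-Gauss quadrature -/

/-- The roots of the Legendre polynomial of degree `P`. -/
def nodes (P : ℕ) : Finset ℝ := (legendre P).roots.toFinset

/-- The quadrature weight on `(a, b)` that belongs to the root `τ`. -/
def qWeight (a b : ℝ) (P : ℕ) (τ : ℝ) : ℝ :=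
  (b - a) / ((1 - τ ^ 2) * ((derivative (legendre P)).eval τ) ^ 2)

/-- The quadrature node in `(a, b)` that belongs to the root `τ`. -/
def qNode (a b τ : ℝ) : ℝ := (b - a) / 2 * τ + (b + a) / 2

/-- The largest absolute value of a quadrature weight of the `P`-point rule on `(a, b)`. -/
def maxWeight (a b : ℝ) (P : ℕ) : ℝ := sSup ((fun τ => |qWeight a b P τ|) '' (nodes P : Set ℝ))

/-- The largest absolute value of `ρ` at a quadrature node of the `P`-point rule on `(a, b)`. -/
def maxAtNodes (a b : ℝ) (P : ℕ) (ρ : ℝ → ℝ) : ℝ :=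
  sSup ((fun τ => |ρ (qNode a b τ)|) '' (nodes P : Set ℝ))

/-- The values `|∂^{2P} H(x,t,γ)/∂γ^{2P}|` for `0 ≤ x, t ≤ 1` and `a < γ < b`. -/
def orderDerivValues (a b : ℝ) (P : ℕ) (H : ℝ → ℝ → ℝ → ℝ) : Set ℝ :=
  {y | ∃ x ∈ I01, ∃ t ∈ I01, ∃ γ ∈ Set.Ioo a b, y = |iteratedDeriv (2 * P) (H x t) γ|}

/-- `H(x,t,·)` is of class `C^{2P}` on `(a, b)` for all `(x,t)`, and the derivatives of order `2P`
are bounded uniformly in `x, t, γ`. -/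
structure OrderRegular (a b : ℝ) (P : ℕ) (H : ℝ → ℝ → ℝ → ℝ) : Prop where
  contDiffOn : ∀ x ∈ I01, ∀ t ∈ I01,
    ContDiffOn ℝ ((2 * P : ℕ) : WithTop ℕ∞) (H x t) (Set.Ioo a b)
  bddAbove : BddAbove (orderDerivValues a b P H)

/-- The supremum of `|∂^{2P} H(x,t,γ)/∂γ^{2P}|` over `0 ≤ x, t ≤ 1` and `a < γ < b`. -/
def orderConst (a b : ℝ) (P : ℕ) (H : ℝ → ℝ → ℝ → ℝ) : ℝ := sSup (orderDerivValues a b P H)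

/-! ### The residual -/

/-- The residual `Res_N(U)`. -/
def residual (ρ₁ ρ₂ : ℝ → ℝ) (κ : ℝ) (f U : ℝ → ℝ → ℝ) (P Q R R' Λ Λ' : ℕ) (x t : ℝ) : ℝ :=
  (∑ τ ∈ nodes P, qWeight 0 1 P τ * ρ₁ (qNode 0 1 τ) *
      trunc R R' Λ Λ' (caputoT (qNode 0 1 τ) U) x t)
    + trunc R R' Λ Λ' U x t
    - κ * (∑ τ ∈ nodes Q, qWeight 1 2 Q τ * ρ₂ (qNode 1 2 τ) *
      trunc R R' Λ Λ' (caputoX (qNode 1 2 τ) U) x t)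
    - trunc R R' Λ Λ' (singularIntegral U) x t
    - trunc R R' Λ Λ' f x t

/-- The `L²` norm on the unit square. -/
def l2Norm (F : ℝ → ℝ → ℝ) : ℝ :=
  √(∫ x in (0 : ℝ)..1, ∫ t in (0 : ℝ)..1, |F x t| ^ 2)

end DistributedOrder

end

/-! The truncated expansion is linear on continuous functions, so the residual is the truncation of
a single function: the operator `L₁` with both order integrals replaced by Legendre-Gauss sums
(`residual_eq_trunc`). For a solution, `L₁ = 0`, and this function is just the difference of two
quadrature errors (`discretizedOperator_eq_of_L₁_eq_zero`). For `R, R' ≥ 1` the tensor wavelets are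
orthonormal, so truncation is an orthogonal projection and Bessel's inequality gives `‖Res‖ ≤
‖quadrature error‖` in `L²` (`l2Norm_trunc_le`).

The rule is exact below degree `2P` and has nonnegative weights of total mass `b - a`, hence its
error is at most `2(b - a)` times the distance to any such polynomial. The Taylor polynomial at the
midpoint of a unit interval gives `2C/4^P ≤ πC/4^P`, which is (a): the wavelet term is nonnegative
and can only enlarge the bound.

For (b), the tail sum is a product of tails of convergent series. For (c), the constants of (a) may
grow with `P`, so (a) does not suffice. Instead the quadrature error tends to zero pointwise by
Weierstrass approximation, and the order-two bound dominates it uniformly in `P` and `Q`; dominated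
convergence concludes. -/

namespace DistributedOrder

/-! ### Integration of polynomials over `[-1, 1]` -/

/-- Integration of polynomials over `[-1, 1]` as a linear functional. -/
noncomputable def polyIntegral : ℝ[X] →ₗ[ℝ] ℝ where
  toFun p := ∫ x in (-1 : ℝ)..1, p.eval x
  map_add' p q := by
    simp only [eval_add]
    exact intervalIntegral.integral_add (p.continuous.intervalIntegrable _ _)
      (q.continuous.intervalIntegrable _ _)
  map_smul' c p := by simp

theorem polyIntegral_apply (p : ℝ[X]) : polyIntegral p = ∫ x in (-1 : ℝ)..1, p.eval x := rfl

theorem polyIntegral_C_mul (c : ℝ) (p : ℝ[X]) : polyIntegral (C c * p) = c * polyIntegral p := by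
  rw [← smul_eq_C_mul, map_smul, smul_eq_mul]

theorem polyIntegral_derivative (p : ℝ[X]) :
    polyIntegral (derivative p) = p.eval 1 - p.eval (-1) :=
  intervalIntegral.integral_eq_sub_of_hasDerivAt (fun x _ => p.hasDerivAt x)
    ((derivative p).continuous.intervalIntegrable _ _)

theorem polyIntegral_derivative_mul {p : ℝ[X]} (h₁ : p.eval 1 = 0) (h₂ : p.eval (-1) = 0)
    (q : ℝ[X]) : polyIntegral (derivative p * q) = -polyIntegral (p * derivative q) := by
  have h := polyIntegral_derivative (p * q)
  rw [derivative_mul, map_add] at h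
  simp only [eval_mul, h₁, h₂, zero_mul, sub_zero] at h
  linarith

/-- Pairing a Legendre polynomial with a suitable factor of itself gives such an integral;
orthogonality makes it vanish, and the contradiction locates the roots and shows that they are
simple. -/
theorem polyIntegral_mul_sq_pos {s q : ℝ[X]} (hs : ∀ x ∈ Set.Ioo (-1 : ℝ) 1, 0 < s.eval x)
    (hq : q ≠ 0) : 0 < polyIntegral (s * (q * q)) := by
  rw [polyIntegral_apply]
  obtain ⟨c, hc, hqc⟩ : ∃ c ∈ Set.Ioo (-1 : ℝ) 1, q.eval c ≠ 0 := by
    by_contra! h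
    refine hq (q.eq_zero_of_infinite_isRoot ((Set.Ioo_infinite ?_).mono fun x hx => h x hx))
    norm_num
  have hnn : ∀ x ∈ Set.Icc (-1 : ℝ) 1, 0 ≤ (s * (q * q)).eval x := by
    have hcl : IsClosed {x : ℝ | 0 ≤ (s * (q * q)).eval x} :=
      isClosed_le continuous_const (s * (q * q)).continuous
    have : closure (Set.Ioo (-1 : ℝ) 1) ⊆ {x : ℝ | 0 ≤ (s * (q * q)).eval x} := by
      refine closure_minimal (fun x hx => ?_) hcl
      simp only [Set.mem_ofPred_eq, eval_mul]
      exact mul_nonneg (hs x hx).le (mul_self_nonneg _)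
    rw [closure_Ioo (by norm_num)] at this
    exact this
  refine intervalIntegral.integral_pos (by norm_num) (s * (q * q)).continuous.continuousOn
    (fun x hx => hnn x (Set.Ioc_subset_Icc_self hx)) ⟨c, Set.Ioo_subset_Icc_self hc, ?_⟩
  simp only [eval_mul]
  exact mul_pos (hs c hc) (mul_self_pos.2 hqc)

/-! ### Legendre polynomials -/

theorem eval_iterate_derivative_sq_sub_one_pow {n k : ℕ} (h : k < n) {r : ℝ} (hr : r ^ 2 = 1) :
    (derivative^[k] ((X ^ 2 - 1 : ℝ[X]) ^ n)).eval r = 0 := by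
  obtain ⟨g, hg⟩ := pow_sub_dvd_iterate_derivative_pow (X ^ 2 - 1 : ℝ[X]) n k
  rw [hg]
  simp [hr, Nat.sub_ne_zero_of_lt h]

/-- Repeated integration by parts; the boundary terms vanish because `±1` are roots of multiplicity
`n` and fewer than `n` derivatives have been taken. -/
theorem polyIntegral_iterate_derivative_mul {n k : ℕ} (h : k ≤ n) (q : ℝ[X]) :
    polyIntegral (derivative^[k] ((X ^ 2 - 1 : ℝ[X]) ^ n) * q) =
      (-1) ^ k * polyIntegral ((X ^ 2 - 1) ^ n * derivative^[k] q) := by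
  induction k generalizing q with
  | zero => simp
  | succ k ih =>
    rw [Function.iterate_succ_apply', polyIntegral_derivative_mul
      (eval_iterate_derivative_sq_sub_one_pow h (by norm_num))
      (eval_iterate_derivative_sq_sub_one_pow h (by norm_num)), ih (Nat.le_of_succ_le h),
      ← Function.iterate_succ_apply]
    ring

theorem polyIntegral_legendre_mul {n : ℕ} {q : ℝ[X]} (hq : q.degree < n) :
    polyIntegral (legendre n * q) = 0 := by
  rw [legendre, mul_assoc, polyIntegral_C_mul, polyIntegral_iterate_derivative_mul le_rfl,
    iterate_derivative_eq_zero_of_degree_lt hq]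
  simp

theorem natDegree_sq_sub_one_pow (n : ℕ) : ((X ^ 2 - 1 : ℝ[X]) ^ n).natDegree = 2 * n := by
  have : (X ^ 2 - 1 : ℝ[X]).natDegree = 2 := by
    rw [← C_1]; exact natDegree_X_pow_sub_C
  rw [natDegree_pow, this, mul_comm]

theorem coeff_legendre_ne_zero (n : ℕ) : (legendre n).coeff n ≠ 0 := by
  have hm : ((X ^ 2 - 1 : ℝ[X]) ^ n).Monic := by
    rw [← C_1]; exact (monic_X_pow_sub_C 1 two_ne_zero).pow n
  have h1 : ((X ^ 2 - 1 : ℝ[X]) ^ n).coeff (n + n) = 1 := by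
    have := hm.coeff_natDegree
    rwa [natDegree_sq_sub_one_pow, two_mul] at this
  rw [legendre, coeff_C_mul, coeff_iterate_derivative, h1]
  have : (n + n).descFactorial n ≠ 0 := by
    rw [Ne, Nat.descFactorial_eq_zero_iff_lt]; omega
  simp [this, Nat.factorial_ne_zero]

theorem natDegree_legendre (n : ℕ) : (legendre n).natDegree = n := by
  refine le_antisymm ?_ (le_natDegree_of_ne_zero (coeff_legendre_ne_zero n))
  refine (natDegree_C_mul_le _ _).trans ((natDegree_iterate_derivative _ _).trans ?_)
  rw [natDegree_sq_sub_one_pow]; omega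

theorem legendre_ne_zero (n : ℕ) : legendre n ≠ 0 := fun h =>
  coeff_legendre_ne_zero n (by simp [h])

theorem degree_legendre (n : ℕ) : (legendre n).degree = n := by
  rw [degree_eq_natDegree (legendre_ne_zero n), natDegree_legendre]

/-- Near `r = ±1` the power factors as `(X - r)^n (X + r)^n`, so its `n`-th derivative at `r` is `n!
(2r)^n`. Squaring treats both end points at once. -/
theorem eval_legendre_sq_eq_one (n : ℕ) {r : ℝ} (hr : r ^ 2 = 1) :
    ((legendre n).eval r) ^ 2 = 1 := by
  have hfac : map (algebraMap ℝ ℝ) ((X ^ 2 - 1 : ℝ[X]) ^ n) = (X - C r) ^ n * (X + C r) ^ n := by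
    rw [← mul_pow, Algebra.algebraMap_self, Polynomial.map_id]
    congr 1
    have : (C r : ℝ[X]) * C r = 1 := by rw [← C_mul, ← sq, hr, C_1]
    linear_combination this
  have h := aeval_iterate_derivative_self _ n r hfac
  rw [coe_aeval_eq_eval] at h
  rw [legendre, eval_mul, eval_C, h]
  simp only [eval_pow, eval_add, eval_X, eval_C, nsmul_eq_mul]
  have h2 : (r + r) ^ n = 2 ^ n * r ^ n := by rw [← mul_pow]; ring
  have hf : (n.factorial : ℝ) ≠ 0 := by exact_mod_cast n.factorial_ne_zero
  rw [h2]
  field_simp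
  rw [← pow_mul, mul_comm, pow_mul, hr, one_pow]

theorem polyIntegral_legendre_mul_legendre (m n : ℕ) :
    polyIntegral (legendre m * legendre n) = if m = n then 2 / (2 * (n : ℝ) + 1) else 0 := by
  split_ifs with h
  · subst h
    -- The integral of `(X p²)' = p² + 2 X p p'` is `2`. The leading terms of `X p'` and `m p`
    -- cancel, so `p` is orthogonal to their difference, and `(2m + 1) ∫ p² = 2` follows.
    have h1 := polyIntegral_derivative (X * (legendre m * legendre m))
    have hdeg : (X * derivative (legendre m) - C (m : ℝ) * legendre m).degree < (m : WithBot ℕ) := by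
      rw [degree_lt_iff_coeff_zero]
      intro k hk
      rcases k with _ | k
      · obtain rfl : m = 0 := by omega
        simp
      · rw [coeff_sub, coeff_X_mul, coeff_derivative, coeff_C_mul]
        rcases hk.eq_or_lt with rfl | hk
        · push_cast; ring
        · rw [coeff_eq_zero_of_natDegree_lt (by rwa [natDegree_legendre])]; ring
    have h2 := polyIntegral_legendre_mul hdeg
    rw [mul_sub, map_sub, mul_left_comm, mul_left_comm _ (C (m : ℝ)), polyIntegral_C_mul] at h2
    have h3 : derivative (X * (legendre m * legendre m)) =
        legendre m * legendre m + C 2 * (X * (legendre m * derivative (legendre m))) := by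
      simp only [derivative_mul, derivative_X, map_ofNat]
      ring
    rw [h3, map_add, polyIntegral_C_mul] at h1
    have e1 := eval_legendre_sq_eq_one m (r := 1) (by norm_num)
    have e2 := eval_legendre_sq_eq_one m (r := -1) (by norm_num)
    simp only [eval_mul, eval_X] at h1
    rw [eq_div_iff (by positivity)]
    linear_combination h1 - 2 * h2 + e1 + e2
  · rcases lt_or_gt_of_ne h with h | h
    · rw [mul_comm]
      exact polyIntegral_legendre_mul (by rw [degree_legendre]; exact_mod_cast h)
    · exact polyIntegral_legendre_mul (by rw [degree_legendre]; exact_mod_cast h)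

/-! ### Roots of the Legendre polynomials -/

theorem card_roots_le_iterate_derivative (p : ℝ[X]) (k : ℕ) :
    p.roots.card ≤ (derivative^[k] p).roots.card + k := by
  induction k with
  | zero => simp
  | succ k ih =>
    rw [Function.iterate_succ_apply']
    have := card_roots_le_derivative (derivative^[k] p)
    omega

/-- By Rolle, each derivative loses at most one root counted with multiplicity, and `(X² - 1)^n`
starts with `2n`. -/
theorem card_roots_legendre (n : ℕ) : (legendre n).roots.card = n := by
  refine le_antisymm ((card_roots' _).trans_eq (natDegree_legendre n)) ?_
  have h := card_roots_le_iterate_derivative ((X ^ 2 - 1 : ℝ[X]) ^ n) n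
  have h2 : ((X ^ 2 - 1 : ℝ[X]) ^ n).roots.card = 2 * n := by
    have : (X ^ 2 - 1 : ℝ[X]) = (X - C 1) * (X - C (-1)) := by
      simp only [C_neg, C_1]; ring
    rw [this, roots_pow, roots_mul (mul_ne_zero (X_sub_C_ne_zero _) (X_sub_C_ne_zero _)),
      roots_X_sub_C, roots_X_sub_C]
    simp [mul_comm]
  rw [legendre, roots_C_mul _ (by positivity)]
  omega

theorem eq_legendre_factor {n : ℕ} {r : ℝ} (hr : (legendre n).IsRoot r) :
    ∃ q : ℝ[X], legendre n = (X - C r) * q ∧ q ≠ 0 ∧ q.degree < n ∧ q.natDegree + 1 = n := by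
  obtain ⟨q, hq⟩ := dvd_iff_isRoot.2 hr
  have hq0 : q ≠ 0 := by
    rintro rfl
    exact legendre_ne_zero n (by simpa using hq)
  have hd : q.natDegree + 1 = n := by
    have := natDegree_legendre n
    rw [hq, natDegree_mul (X_sub_C_ne_zero r) hq0, natDegree_X_sub_C] at this
    omega
  refine ⟨q, hq, hq0, ?_, hd⟩
  rw [degree_eq_natDegree hq0]
  exact_mod_cast (by omega : q.natDegree < n)

/-- Write `p = (X - r) q`. If `r` lay outside the open interval, `p q = (X - r) q²` would have
constant sign, although `p` is orthogonal to `q`. -/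
theorem legendre_root_mem_Ioo {n : ℕ} {r : ℝ} (hr : (legendre n).IsRoot r) :
    r ∈ Set.Ioo (-1 : ℝ) 1 := by
  obtain ⟨q, hq, hq0, hqd, -⟩ := eq_legendre_factor hr
  have h0 := polyIntegral_legendre_mul hqd
  rw [hq, mul_assoc] at h0
  by_contra hmem
  rw [Set.mem_Ioo, not_and_or, not_lt, not_lt] at hmem
  rcases hmem with h | h
  · have := polyIntegral_mul_sq_pos (s := X - C r) (fun x hx => by
      simp only [eval_sub, eval_X, eval_C]; linarith [hx.1]) hq0
    linarith
  · have := polyIntegral_mul_sq_pos (s := C (-1) * (X - C r)) (fun x hx => by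
      simp only [eval_mul, eval_sub, eval_X, eval_C]; linarith [hx.2]) hq0
    rw [mul_assoc, polyIntegral_C_mul] at this
    linarith

/-- If `p = (X - r)² q`, then `p q` is the square of `(X - r) q`, against the orthogonality of `p`
to `q`. -/
theorem nodup_roots_legendre (n : ℕ) : (legendre n).roots.Nodup := by
  classical
  rw [Multiset.nodup_iff_count_le_one]
  intro r
  rw [count_roots]
  by_contra! h
  obtain ⟨q, hq⟩ := (le_rootMultiplicity_iff (legendre_ne_zero n)).1 h
  have hq0 : q ≠ 0 := by
    rintro rfl
    exact legendre_ne_zero n (by simpa using hq)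
  have hd : q.degree < n := by
    have hn : q.natDegree < n := by
      have := natDegree_legendre n
      rw [hq, natDegree_mul (pow_ne_zero _ (X_sub_C_ne_zero r)) hq0, natDegree_pow,
        natDegree_X_sub_C] at this
      omega
    rw [degree_eq_natDegree hq0]
    exact_mod_cast hn
  have h0 := polyIntegral_legendre_mul hd
  have := polyIntegral_mul_sq_pos (s := 1) (q := (X - C r) * q) (by simp)
    (mul_ne_zero (X_sub_C_ne_zero r) hq0)
  rw [show (1 : ℝ[X]) * ((X - C r) * q * ((X - C r) * q)) = (X - C r) ^ (1 + 1) * q * q by ring,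
    ← hq, h0] at this
  exact lt_irrefl _ this

theorem card_nodes (n : ℕ) : (nodes n).card = n := by
  rw [nodes, Multiset.toFinset_card_of_nodup (nodup_roots_legendre n), card_roots_legendre]

theorem mem_nodes {n : ℕ} {r : ℝ} : r ∈ nodes n ↔ (legendre n).IsRoot r := by
  rw [nodes, Multiset.mem_toFinset, mem_roots (legendre_ne_zero n)]

theorem node_mem_Ioo {n : ℕ} {r : ℝ} (hr : r ∈ nodes n) : r ∈ Set.Ioo (-1 : ℝ) 1 :=
  legendre_root_mem_Ioo (mem_nodes.1 hr)

/-! ### Exactness of Legendre-Gauss quadrature -/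

/-- Divide `F` by the Legendre polynomial: the quotient term integrates to zero by orthogonality,
and the remainder agrees with `F` at the nodes and is recovered there by Lagrange interpolation. -/
theorem exists_gauss_weights (n : ℕ) : ∃ v : ℝ → ℝ, ∀ F : ℝ[X], F.degree < (2 * n : ℕ) →
    polyIntegral F = ∑ τ ∈ nodes n, v τ * F.eval τ := by
  classical
  refine ⟨fun τ => polyIntegral (Lagrange.basis (nodes n) id τ), fun F hF => ?_⟩
  set p := legendre n with hp
  have hp0 : p ≠ 0 := legendre_ne_zero n
  have hdm := EuclideanDomain.div_add_mod F p
  have hmod : (F % p).degree < n := (degree_mod_lt F hp0).trans_eq (degree_legendre n)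
  have hdiv : (F / p).degree < n := by
    by_cases hle : p.degree ≤ F.degree
    · have h := degree_add_div hp0 hle
      by_cases h0 : F / p = 0
      · rw [h0, degree_zero]; exact WithBot.bot_lt_coe n
      · rw [degree_eq_natDegree h0, show p.degree = n from degree_legendre n] at h
        rw [← h] at hF
        rw [degree_eq_natDegree h0]
        norm_cast at hF ⊢
        omega
    · rw [(Polynomial.div_eq_zero_iff hp0).2 (not_le.1 hle), degree_zero]
      exact WithBot.bot_lt_coe n
  have hev : ∀ τ ∈ nodes n, (F % p).eval τ = F.eval τ := by
    intro τ hτ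
    have hr : p.eval τ = 0 := mem_nodes.1 hτ
    conv_rhs => rw [← hdm, eval_add, eval_mul, hr, zero_mul, zero_add]
  have hint := Lagrange.eq_interpolate (s := nodes n) (v := id) (f := F % p)
    Function.injective_id.injOn (by rwa [card_nodes])
  rw [Lagrange.interpolate_apply] at hint
  conv_lhs => rw [← hdm, map_add, polyIntegral_legendre_mul hdiv, zero_add, hint, map_sum]
  refine Finset.sum_congr rfl fun τ hτ => ?_
  rw [polyIntegral_C_mul, id, hev τ hτ, mul_comm]

/-- The abstract weight at `τ` is identified with the explicit one. With `p = (X - τ) q`, the factor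
`q` vanishes at the other nodes and `q(τ) = p'(τ)`, so testing the rule on `q²` and on `p' q` gives
the same value `v(τ) q(τ)²`. -/
theorem polyIntegral_eq_sum_nodes {n : ℕ} {F : ℝ[X]} (hF : F.degree < (2 * n : ℕ)) :
    polyIntegral F = ∑ τ ∈ nodes n, qWeight (-1) 1 n τ * F.eval τ := by
  obtain ⟨v, hv⟩ := exists_gauss_weights n
  rw [hv F hF]
  refine Finset.sum_congr rfl fun τ hτ => ?_
  congr 1
  obtain ⟨q, hq, hq0, -, hqd⟩ := eq_legendre_factor (mem_nodes.1 hτ)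
  have hder : derivative (legendre n) = q + (X - C τ) * derivative q := by
    rw [hq]; simp
  have hqτ : (derivative (legendre n)).eval τ = q.eval τ := by rw [hder]; simp
  have hqσ : ∀ σ ∈ nodes n, σ ≠ τ → q.eval σ = 0 := by
    intro σ hσ hne
    have h : (legendre n).eval σ = 0 := mem_nodes.1 hσ
    rw [hq, eval_mul, eval_sub, eval_X, eval_C] at h
    exact (mul_eq_zero.1 h).resolve_left (sub_ne_zero.2 hne)
  have hsum : ∀ r : ℝ[X], r.natDegree ≤ q.natDegree →
      polyIntegral (r * q) = v τ * (r.eval τ * q.eval τ) := by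
    intro r hr
    rw [hv, Finset.sum_eq_single_of_mem τ hτ]
    · rw [eval_mul]
    · intro σ hσ hne
      rw [eval_mul, hqσ σ hσ hne]; ring
    · refine (degree_le_natDegree).trans_lt ?_
      have := natDegree_mul_le (p := r) (q := q)
      exact_mod_cast (by omega : (r * q).natDegree < 2 * n)
  have h1 := hsum q le_rfl
  have h2 := hsum (derivative (legendre n)) (by
    have := natDegree_derivative_le (legendre n)
    rw [natDegree_legendre] at this
    omega)
  have h3 := polyIntegral_derivative ((X - C τ) * (q * q))
  have h4 : derivative ((X - C τ) * (q * q)) = C 2 * (derivative (legendre n) * q) - q * q := by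
    rw [hder]
    simp only [derivative_mul, derivative_sub, derivative_X, derivative_C, map_ofNat]
    ring
  rw [h4, map_sub, polyIntegral_C_mul, h1, h2, hqτ] at h3
  have hmem := node_mem_Ioo hτ
  have e1 := eval_legendre_sq_eq_one n (r := 1) (by norm_num)
  have e2 := eval_legendre_sq_eq_one n (r := -1) (by norm_num)
  rw [hq] at e1 e2
  simp only [eval_mul, eval_sub, eval_X, eval_C] at e1 e2 h3
  have hp1 : 0 < 1 - τ := by linarith [hmem.2]
  have hp2 : 0 < 1 + τ := by linarith [hmem.1]
  -- Integrating `((X - τ) q²)' = 2 p' q - q²` leaves boundary terms, which `p(±1)² = 1` turns into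
  -- `1/(1 - τ) + 1/(1 + τ)`.
  have key : v τ * (q.eval τ) ^ 2 * (1 - τ ^ 2) = 2 := by
    linear_combination (1 - τ ^ 2) * h3 + (1 + τ) * e1 + (1 - τ) * e2
  have hne : q.eval τ ≠ 0 := by
    intro h0
    rw [h0] at key
    norm_num at key
  have h12 : 1 - τ ^ 2 ≠ 0 := by nlinarith
  rw [qWeight, hqτ, eq_div_iff (mul_ne_zero h12 (pow_ne_zero 2 hne))]
  linarith

theorem qWeight_nonneg {a b : ℝ} (hab : a ≤ b) {n : ℕ} {τ : ℝ} (hτ : τ ∈ nodes n) :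
    0 ≤ qWeight a b n τ := by
  have hm := node_mem_Ioo hτ
  have : 0 ≤ 1 - τ ^ 2 := by nlinarith [hm.1, hm.2]
  exact div_nonneg (sub_nonneg.2 hab) (mul_nonneg this (sq_nonneg _))

theorem qNode_mem_Ioo {a b : ℝ} (hab : a < b) {n : ℕ} {τ : ℝ} (hτ : τ ∈ nodes n) :
    qNode a b τ ∈ Set.Ioo a b := by
  have hm := node_mem_Ioo hτ
  have h : 0 < b - a := sub_pos.2 hab
  rw [qNode]
  constructor <;> nlinarith [hm.1, hm.2]

theorem integral_eval_eq_sum_nodes {a b : ℝ} (hab : a < b) {n : ℕ} {F : ℝ[X]}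
    (hF : F.natDegree < 2 * n) :
    ∫ x in a..b, F.eval x = ∑ τ ∈ nodes n, qWeight a b n τ * F.eval (qNode a b τ) := by
  have hc : (b - a) / 2 ≠ 0 := by have := sub_pos.2 hab; positivity
  set G : ℝ[X] := F.comp (C ((b - a) / 2) * X + C ((b + a) / 2)) with hG
  have hGe : ∀ u, G.eval u = F.eval (qNode a b u) := fun u => by simp [hG, qNode]
  have hGd : G.degree < (2 * n : ℕ) := by
    refine degree_le_natDegree.trans_lt ?_
    have : G.natDegree = F.natDegree := by
      rw [hG, natDegree_comp, natDegree_linear hc, mul_one]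
    rw [this]
    exact_mod_cast hF
  have h := polyIntegral_eq_sum_nodes hGd
  rw [polyIntegral_apply] at h
  simp only [hGe] at h
  have h2 := intervalIntegral.integral_comp_mul_add (a := -1) (b := 1) (fun x => F.eval x) hc
    ((b + a) / 2)
  simp only [← qNode.eq_1] at h2
  rw [h, show qNode a b (-1) = a by rw [qNode]; ring,
    show qNode a b 1 = b by rw [qNode]; ring, smul_eq_mul, eq_inv_mul_iff_mul_eq₀ hc,
    Finset.mul_sum] at h2
  rw [← h2]
  refine Finset.sum_congr rfl fun τ _ => ?_
  rw [qWeight, qWeight]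
  ring

/-! ### The error of Legendre-Gauss quadrature -/

/-- The value of the `P`-point Legendre-Gauss quadrature rule on `(a, b)`. -/
noncomputable def quadrature (a b : ℝ) (P : ℕ) (f : ℝ → ℝ) : ℝ :=
  ∑ τ ∈ nodes P, qWeight a b P τ * f (qNode a b τ)

/-- Exactness on `T` cancels the polynomial part. The rule and the integral of `f - T` are each at
most `(b - a) δ`, the former because the weights are nonnegative and sum to `b - a`. -/
theorem abs_quadrature_sub_integral_le {a b δ : ℝ} (hab : a < b) {P : ℕ} {f : ℝ → ℝ} {T : ℝ[X]}
    (hf : ContinuousOn f (Set.Ioo a b)) (hT : T.natDegree < 2 * P)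
    (h : ∀ x ∈ Set.Ioo a b, |f x - T.eval x| ≤ δ) :
    |quadrature a b P f - ∫ x in a..b, f x| ≤ 2 * (b - a) * δ := by
  have hTi : IntervalIntegrable (fun x => T.eval x) MeasureTheory.volume a b :=
    T.continuous.intervalIntegrable _ _
  have hri : MeasureTheory.IntegrableOn (fun x => f x - T.eval x) (Set.Ioo a b)
      MeasureTheory.volume := by
    refine MeasureTheory.IntegrableOn.of_bound (by simp)
      ((hf.sub T.continuous.continuousOn).aestronglyMeasurable measurableSet_Ioo) δ ?_
    exact MeasureTheory.ae_restrict_of_forall_mem measurableSet_Ioo h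
  have hri' : IntervalIntegrable (fun x => f x - T.eval x) MeasureTheory.volume a b := by
    rwa [intervalIntegrable_iff_integrableOn_Ioo_of_le hab.le]
  have hfi : ∫ x in a..b, f x = (∫ x in a..b, T.eval x) + ∫ x in a..b, (f x - T.eval x) := by
    rw [← intervalIntegral.integral_add hTi hri']
    simp
  have hq : quadrature a b P f = (∫ x in a..b, T.eval x) +
      quadrature a b P (fun x => f x - T.eval x) := by
    rw [integral_eval_eq_sum_nodes hab hT, quadrature, quadrature, ← Finset.sum_add_distrib]
    exact Finset.sum_congr rfl fun τ _ => by ring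
  have hw : ∑ τ ∈ nodes P, qWeight a b P τ = b - a := by
    have := integral_eval_eq_sum_nodes hab (n := P) (F := 1) (by rw [natDegree_one]; omega)
    simpa using this.symm
  have e1 : |quadrature a b P (fun x => f x - T.eval x)| ≤ (b - a) * δ := by
    rw [quadrature, ← hw, Finset.sum_mul]
    refine (Finset.abs_sum_le_sum_abs _ _).trans (Finset.sum_le_sum fun τ hτ => ?_)
    rw [abs_mul, abs_of_nonneg (qWeight_nonneg hab.le hτ)]
    exact mul_le_mul_of_nonneg_left (h _ (qNode_mem_Ioo hab hτ)) (qWeight_nonneg hab.le hτ)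
  have e2 : |∫ x in a..b, (f x - T.eval x)| ≤ (b - a) * δ := by
    rw [intervalIntegral.integral_of_le hab.le, MeasureTheory.integral_Ioc_eq_integral_Ioo]
    have := MeasureTheory.norm_setIntegral_le_of_norm_le_const (μ := MeasureTheory.volume)
      (s := Set.Ioo a b) (by simp) (fun x hx => (Real.norm_eq_abs _).trans_le (h x hx))
    rw [Real.norm_eq_abs, Real.volume_real_Ioo_of_le hab.le] at this
    linarith
  rw [hq, hfi, add_sub_add_left_eq_sub]
  linarith [abs_sub (quadrature a b P (fun x => f x - T.eval x)) (∫ x in a..b, (f x - T.eval x))]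

/-- Lagrange remainder at the midpoint, where `|x - c| ≤ (b - a)/2`. The factor `1/m!` is discarded.
-/
theorem exists_polynomial_taylor {a b C : ℝ} {m : ℕ} (hm : 1 ≤ m) {f : ℝ → ℝ} (hab : a < b)
    (hf : ContDiffOn ℝ (m : WithTop ℕ∞) f (Set.Ioo a b))
    (hC : ∀ x ∈ Set.Ioo a b, |iteratedDeriv m f x| ≤ C) :
    ∃ T : ℝ[X], T.natDegree < m ∧ ∀ x ∈ Set.Ioo a b, |f x - T.eval x| ≤ C * ((b - a) / 2) ^ m := by
  obtain ⟨n, rfl⟩ : ∃ n, m = n + 1 := ⟨m - 1, by omega⟩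
  set c := (a + b) / 2 with hc
  have hcm : c ∈ Set.Ioo a b := by constructor <;> linarith
  have hC0 : 0 ≤ C := (abs_nonneg _).trans (hC c hcm)
  refine ⟨∑ k ∈ Finset.range (n + 1),
    Polynomial.C ((k.factorial : ℝ)⁻¹ * iteratedDeriv k f c) * (X - Polynomial.C c) ^ k, ?_, ?_⟩
  · refine Nat.lt_succ_of_le (natDegree_sum_le_of_forall_le _ _ fun k hk => ?_)
    refine (natDegree_C_mul_le _ _).trans ?_
    rw [natDegree_pow, natDegree_X_sub_C, mul_one]
    exact Nat.lt_succ_iff.1 (Finset.mem_range.1 hk)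
  · intro x hx
    have hba : 0 ≤ (b - a) / 2 := by linarith
    -- The Lagrange remainder needs distinct points; at the centre only the constant term survives
    -- and the error is zero.
    rcases eq_or_ne c x with rfl | hne
    · simp only [eval_finsetSum, eval_mul, eval_C, eval_pow, eval_sub, eval_X, sub_self]
      rw [Finset.sum_eq_single_of_mem 0 (by simp) (fun k _ hk => by simp [hk])]
      simp only [Nat.factorial_zero, Nat.cast_one, inv_one, one_mul, iteratedDeriv_zero, pow_zero,
        mul_one, sub_self, abs_zero]
      positivity
    · have hsub : Set.uIcc c x ⊆ Set.Ioo a b := Set.ordConnected_Ioo.uIcc_subset hcm hx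
      obtain ⟨y, hy, hxy⟩ := taylor_mean_remainder_lagrange_iteratedDeriv (n := n) hne
        ((hf.mono hsub).of_le (by simp))
      have hT : taylorWithinEval f n (Set.uIcc c x) c x =
          (∑ k ∈ Finset.range (n + 1), Polynomial.C ((k.factorial : ℝ)⁻¹ * iteratedDeriv k f c) *
            (X - Polynomial.C c) ^ k).eval x := by
        rw [taylor_within_apply, eval_finsetSum]
        refine Finset.sum_congr rfl fun k hk => ?_
        have hk' : (k : WithTop ℕ∞) ≤ ((n + 1 : ℕ) : WithTop ℕ∞) := by
          exact_mod_cast (Finset.mem_range.1 hk).le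
        rw [iteratedDerivWithin_eq_iteratedDeriv (uniqueDiffOn_uIcc hne)
          ((hf.contDiffAt (Ioo_mem_nhds hcm.1 hcm.2)).of_le hk') Set.left_mem_uIcc]
        simp only [smul_eq_mul, eval_mul, eval_C, eval_pow, eval_sub, eval_X]
        ring
      rw [← hT, hxy, abs_div, abs_mul, abs_pow, Nat.abs_cast]
      have h1 : |x - c| ≤ (b - a) / 2 := by
        rw [abs_le]; constructor <;> linarith [hx.1, hx.2]
      have hf1 : (1 : ℝ) ≤ ((n + 1).factorial : ℝ) := by
        exact_mod_cast Nat.one_le_iff_ne_zero.2 (Nat.factorial_ne_zero _)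
      refine (div_le_self (by positivity) hf1).trans ?_
      have hy' : y ∈ Set.Ioo a b := hsub (Set.Ioo_subset_Icc_self hy)
      exact mul_le_mul (hC y hy') (pow_le_pow_left₀ (abs_nonneg _) h1 _) (by positivity) hC0

/-- The smoothness index `m` is kept apart from the number of nodes: `m = P` serves the explicit
bound, `m = 1` the majorant for dominated convergence. -/
theorem abs_quadrature_sub_integral_le_of_contDiffOn {a b C : ℝ} (hab : b = a + 1) {m P : ℕ}
    (hm : 1 ≤ m) (hmP : m ≤ P) {f : ℝ → ℝ}
    (hf : ContDiffOn ℝ ((2 * m : ℕ) : WithTop ℕ∞) f (Set.Ioo a b))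
    (hC : ∀ x ∈ Set.Ioo a b, |iteratedDeriv (2 * m) f x| ≤ C) :
    |quadrature a b P f - ∫ x in a..b, f x| ≤ 2 * C / 4 ^ m := by
  have hlt : a < b := by linarith
  obtain ⟨T, hT, h⟩ := exists_polynomial_taylor (by omega) hlt hf hC
  refine (abs_quadrature_sub_integral_le hlt hf.continuousOn (by omega) h).trans_eq ?_
  rw [show b - a = 1 by linarith, pow_mul, show ((1 : ℝ) / 2) ^ 2 = 1 / 4 by norm_num, one_div_pow]
  ring

/-- Weierstrass approximation needs continuity on the closed interval, while regularity is known
only inside. A bounded second derivative bounds the first, and a Lipschitz function extends. -/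
theorem exists_lipschitzWith_eqOn {a b C : ℝ} (hab : a < b) {f : ℝ → ℝ}
    (hf : ContDiffOn ℝ 2 f (Set.Ioo a b)) (hC : ∀ x ∈ Set.Ioo a b, |iteratedDeriv 2 f x| ≤ C) :
    ∃ K : NNReal, ∃ g : ℝ → ℝ, LipschitzWith K g ∧ Set.EqOn f g (Set.Ioo a b) := by
  set c := (a + b) / 2 with hc
  have hcm : c ∈ Set.Ioo a b := by constructor <;> linarith
  have hC0 : 0 ≤ C := (abs_nonneg _).trans (hC c hcm)
  have hd1 : ∀ x ∈ Set.Ioo a b, DifferentiableAt ℝ f x := fun x hx =>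
    (hf.contDiffAt (Ioo_mem_nhds hx.1 hx.2)).differentiableAt (by simp)
  have hd2 : ∀ x ∈ Set.Ioo a b, DifferentiableAt ℝ (deriv f) x := fun x hx =>
    ((hf.deriv_of_isOpen (m := 1) isOpen_Ioo (by norm_num)).contDiffAt
      (Ioo_mem_nhds hx.1 hx.2)).differentiableAt (by simp)
  have hb : ∀ x ∈ Set.Ioo a b, ‖deriv f x‖ ≤ |deriv f c| + C * (b - a) := by
    intro x hx
    have h := (convex_Ioo a b).norm_image_sub_le_of_norm_deriv_le (f := deriv f) (C := C) hd2
      (fun y hy => by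
        have := hC y hy
        rwa [iteratedDeriv_succ, iteratedDeriv_one] at this) hcm hx
    have h1 : ‖x - c‖ ≤ b - a := by
      rw [Real.norm_eq_abs, abs_le]; constructor <;> linarith [hx.1, hx.2]
    have h2 := norm_sub_norm_le (deriv f x) (deriv f c)
    have h3 := mul_le_mul_of_nonneg_left h1 hC0
    rw [← Real.norm_eq_abs]
    linarith
  have hK : 0 ≤ |deriv f c| + C * (b - a) := (norm_nonneg _).trans (hb c hcm)
  have hL : LipschitzOnWith ⟨_, hK⟩ f (Set.Ioo a b) :=
    (convex_Ioo a b).lipschitzOnWith_of_nnnorm_deriv_le hd1 fun x hx => hb x hx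
  exact ⟨_, hL.extend_real⟩

theorem tendsto_quadrature {a b C : ℝ} (hab : a < b) {f : ℝ → ℝ}
    (hf : ContDiffOn ℝ 2 f (Set.Ioo a b)) (hC : ∀ x ∈ Set.Ioo a b, |iteratedDeriv 2 f x| ≤ C) :
    Tendsto (fun P => quadrature a b P f) atTop (𝓝 (∫ x in a..b, f x)) := by
  obtain ⟨K, g, hg, hfg⟩ := exists_lipschitzWith_eqOn hab hf hC
  rw [Metric.tendsto_atTop]
  intro ε hε
  have hba : 0 < b - a := sub_pos.2 hab
  obtain ⟨T, hT⟩ := exists_polynomial_near_of_continuousOn a b g hg.continuous.continuousOn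
    (ε / (4 * (b - a))) (by positivity)
  refine ⟨T.natDegree + 1, fun P hP => ?_⟩
  have := abs_quadrature_sub_integral_le hab (P := P) (T := T) hf.continuousOn (by omega)
    (fun x hx => by
      rw [hfg hx, abs_sub_comm]
      exact (hT x (Set.Ioo_subset_Icc_self hx)).le)
  rw [Real.dist_eq]
  refine this.trans_lt ?_
  rw [show 2 * (b - a) * (ε / (4 * (b - a))) = ε / 2 by field_simp; norm_num]
  linarith

open MeasureTheory

/-! ### Bessel's inequality -/

/-- Expand `0 ≤ ‖F - T‖²`, where `T` is the projection: both `⟨F, T⟩` and `‖T‖²` equal the sum of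
the squared coefficients. -/
theorem integral_sq_sum_le {Ω ι : Type*} [MeasurableSpace Ω] {μ : Measure Ω} [DecidableEq ι]
    {s : Finset ι} {e : ι → Ω → ℝ} {F : Ω → ℝ} (he : ∀ i ∈ s, MemLp (e i) 2 μ)
    (hF : MemLp F 2 μ)
    (ho : ∀ i ∈ s, ∀ j ∈ s, ∫ z, e i z * e j z ∂μ = if i = j then 1 else 0) :
    ∫ z, (∑ i ∈ s, (∫ w, F w * e i w ∂μ) * e i z) ^ 2 ∂μ ≤ ∫ z, F z ^ 2 ∂μ := by
  set c : ι → ℝ := fun i => ∫ w, F w * e i w ∂μ with hc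
  have hT : MemLp (fun z => ∑ i ∈ s, c i * e i z) 2 μ :=
    memLp_finsetSum s fun i hi => (he i hi).const_mul (c i)
  have hFT : ∫ z, F z * ∑ i ∈ s, c i * e i z ∂μ = ∑ i ∈ s, c i ^ 2 := by
    simp only [Finset.mul_sum]
    rw [integral_finsetSum]
    · refine Finset.sum_congr rfl fun i _ => ?_
      simp only [mul_left_comm _ (c i)]
      rw [integral_const_mul, sq]
    · intro i hi
      exact hF.integrable_mul ((he i hi).const_mul (c i))
  have hTT : ∫ z, (∑ i ∈ s, c i * e i z) ^ 2 ∂μ = ∑ i ∈ s, c i ^ 2 := by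
    simp only [sq, Finset.sum_mul_sum]
    have hij : ∀ i ∈ s, ∀ j ∈ s, Integrable (fun z => c i * e i z * (c j * e j z)) μ :=
      fun i hi j hj => ((he i hi).const_mul (c i)).integrable_mul ((he j hj).const_mul (c j))
    rw [integral_finsetSum _ fun i hi => integrable_finsetSum _ fun j hj => hij i hi j hj]
    refine Finset.sum_congr rfl fun i hi => ?_
    rw [integral_finsetSum _ fun j hj => hij i hi j hj]
    have hmul : ∀ j ∈ s, ∫ z, c i * e i z * (c j * e j z) ∂μ =
        c i * c j * if i = j then 1 else 0 := fun j hj => by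
      rw [← ho i hi j hj, ← integral_const_mul]
      congr 1 with z
      ring
    rw [Finset.sum_congr rfl hmul]
    simp [hi]
  have h0 : 0 ≤ ∫ z, (F z - ∑ i ∈ s, c i * e i z) ^ 2 ∂μ := integral_nonneg fun z => sq_nonneg _
  have hexp : ∫ z, (F z - ∑ i ∈ s, c i * e i z) ^ 2 ∂μ =
      ∫ z, F z ^ 2 ∂μ - 2 * ∫ z, F z * ∑ i ∈ s, c i * e i z ∂μ +
        ∫ z, (∑ i ∈ s, c i * e i z) ^ 2 ∂μ := by
    have i1 := hF.integrable_sq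
    have i2 : Integrable (fun z => F z * ∑ i ∈ s, c i * e i z) μ := hF.integrable_mul hT
    have i3 := hT.integrable_sq
    have i4 : Integrable (fun z => F z ^ 2 - 2 * (F z * ∑ i ∈ s, c i * e i z)) μ :=
      i1.sub (i2.const_mul 2)
    rw [← integral_const_mul, ← integral_sub i1 (i2.const_mul 2), ← integral_add i4 i3]
    congr 1 with z
    ring
  rw [hexp, hFT, hTT] at h0
  rw [hTT]
  linarith

/-! ### Lebesgue measure on the unit interval and the unit square -/

/-- Lebesgue measure on `[0, 1]`. -/
noncomputable def unitMeasure : Measure ℝ := volume.restrict I01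

instance : IsFiniteMeasure unitMeasure := by unfold unitMeasure; infer_instance

/-- Lebesgue measure on `[0, 1] × [0, 1]`. -/
noncomputable def squareMeasure : Measure (ℝ × ℝ) := unitMeasure.prod unitMeasure

instance : IsFiniteMeasure squareMeasure := by unfold squareMeasure; infer_instance

theorem squareMeasure_eq : squareMeasure = volume.restrict (I01 ×ˢ I01) :=
  Measure.prod_restrict _ _

theorem squareMeasure_real_univ : squareMeasure.real Set.univ = 1 := by
  rw [squareMeasure_eq, measureReal_restrict_apply_univ, Measure.volume_eq_prod,
    measureReal_prod_prod]
  simp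

theorem intervalIntegral_eq_unitMeasure (f : ℝ → ℝ) :
    ∫ x in (0 : ℝ)..1, f x = ∫ x, f x ∂unitMeasure := by
  rw [intervalIntegral.integral_of_le zero_le_one, unitMeasure, integral_Icc_eq_integral_Ioc]

theorem intervalIntegral_eq_squareMeasure {F : ℝ → ℝ → ℝ}
    (hF : Integrable (fun z : ℝ × ℝ => F z.1 z.2) squareMeasure) :
    ∫ x in (0 : ℝ)..1, ∫ t in (0 : ℝ)..1, F x t = ∫ z, F z.1 z.2 ∂squareMeasure := by
  simp only [intervalIntegral_eq_unitMeasure]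
  rw [squareMeasure, integral_prod _ hF]

theorem ae_mem_square : ∀ᵐ z ∂squareMeasure, z ∈ I01 ×ˢ I01 := by
  rw [squareMeasure_eq]
  exact ae_restrict_mem (measurableSet_Icc.prod measurableSet_Icc)

/-- `F` is continuous on the unit square. -/
abbrev SquareContinuous (F : ℝ → ℝ → ℝ) : Prop :=
  ContinuousOn (fun p : ℝ × ℝ => F p.1 p.2) (I01 ×ˢ I01)

theorem SquareContinuous.exists_bound {F : ℝ → ℝ → ℝ} (hF : SquareContinuous F) :
    ∃ C, ∀ x ∈ I01, ∀ t ∈ I01, |F x t| ≤ C := by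
  obtain ⟨C, hC⟩ := (isCompact_Icc.prod isCompact_Icc).exists_bound_of_continuousOn hF
  exact ⟨C, fun x hx t ht => hC (x, t) ⟨hx, ht⟩⟩

theorem SquareContinuous.aestronglyMeasurable {F : ℝ → ℝ → ℝ} (hF : SquareContinuous F) :
    AEStronglyMeasurable (fun z : ℝ × ℝ => F z.1 z.2) squareMeasure := by
  rw [squareMeasure_eq]
  exact ContinuousOn.aestronglyMeasurable hF (measurableSet_Icc.prod measurableSet_Icc)

theorem SquareContinuous.memLp {F : ℝ → ℝ → ℝ} (hF : SquareContinuous F) :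
    MemLp (fun z : ℝ × ℝ => F z.1 z.2) 2 squareMeasure := by
  obtain ⟨C, hC⟩ := hF.exists_bound
  refine MemLp.of_bound hF.aestronglyMeasurable C ?_
  filter_upwards [ae_mem_square] with z hz using hC z.1 hz.1 z.2 hz.2

/-! ### Orthonormality of the Legendre wavelets -/

theorem wavelet_eq_indicator (R h g : ℕ) : wavelet R h g =
    (Set.Icc (((h : ℝ) - 1) / 2 ^ (R - 1)) ((h : ℝ) / 2 ^ (R - 1))).indicator (fun t =>
      √((g : ℝ) + 1 / 2) * (2 : ℝ) ^ ((R : ℝ) / 2) * (legendre g).eval (2 ^ R * t - 2 * h + 1)) := by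
  ext t
  rw [wavelet, Set.indicator_apply]
  simp only [Set.mem_Icc]

theorem continuous_wavelet_formula (R h g : ℕ) : Continuous (fun t : ℝ =>
    √((g : ℝ) + 1 / 2) * (2 : ℝ) ^ ((R : ℝ) / 2) *
      (legendre g).eval (2 ^ R * t - 2 * h + 1)) :=
  continuous_const.mul ((legendre g).continuous.comp (by fun_prop))

theorem measurable_wavelet (R h g : ℕ) : Measurable (wavelet R h g) := by
  rw [wavelet_eq_indicator]
  exact (continuous_wavelet_formula R h g).measurable.indicator measurableSet_Icc

theorem exists_wavelet_bound (R h g : ℕ) : ∃ C, ∀ t, |wavelet R h g t| ≤ C := by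
  obtain ⟨C, hC⟩ := (isCompact_Icc (a := ((h : ℝ) - 1) / 2 ^ (R - 1))
    (b := (h : ℝ) / 2 ^ (R - 1))).exists_bound_of_continuousOn
      (continuous_wavelet_formula R h g).continuousOn
  refine ⟨max C 0, fun t => ?_⟩
  rw [wavelet_eq_indicator]
  by_cases ht : t ∈ Set.Icc (((h : ℝ) - 1) / 2 ^ (R - 1)) ((h : ℝ) / 2 ^ (R - 1))
  · rw [Set.indicator_of_mem ht]
    exact (hC t ht).trans (le_max_left _ _)
  · rw [Set.indicator_of_notMem ht, abs_zero]
    exact le_max_right _ _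

/-- The supports are closed intervals, so neighbouring ones share an end point; outside this null
set the product vanishes. -/
theorem integral_wavelet_mul_of_lt {R h h' : ℕ} (hlt : h < h') (g g' : ℕ) :
    ∫ t, wavelet R h g t * wavelet R h' g' t ∂unitMeasure = 0 := by
  refine integral_eq_zero_of_ae ?_
  have hne : ∀ᵐ t ∂unitMeasure, t ≠ (h : ℝ) / 2 ^ (R - 1) := by
    refine ae_restrict_of_ae ?_
    rw [ae_iff]
    simp
  filter_upwards [hne] with t ht
  rw [wavelet_eq_indicator, wavelet_eq_indicator, Set.indicator_apply, Set.indicator_apply,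
    Pi.zero_apply]
  split_ifs with h1 h2
  · refine absurd (le_antisymm h1.2 (le_trans ?_ h2.1)) ht
    have : (h : ℝ) + 1 ≤ h' := by exact_mod_cast hlt
    gcongr
    linarith
  all_goals simp

/-- The affine substitution carries the support onto `[-1, 1]`. Its Jacobian cancels `2^R`, and `g +
1/2` cancels the squared norm `2/(2g + 1)`. -/
theorem integral_wavelet_mul_self {R h : ℕ} (hR : 1 ≤ R) (hh : h ∈ Finset.Icc 1 (2 ^ (R - 1)))
    (g g' : ℕ) :
    ∫ t, wavelet R h g t * wavelet R h g' t ∂unitMeasure = if g = g' then 1 else 0 := by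
  rw [Finset.mem_Icc] at hh
  have hpow : (2 : ℝ) ^ R = 2 * 2 ^ (R - 1) := by
    rw [← pow_succ', Nat.sub_add_cancel hR]
  have hp : (0 : ℝ) < 2 ^ (R - 1) := by positivity
  have h1 : (1 : ℝ) ≤ h := by exact_mod_cast hh.1
  have h2 : (h : ℝ) ≤ 2 ^ (R - 1) := by exact_mod_cast hh.2
  set a := ((h : ℝ) - 1) / 2 ^ (R - 1) with ha
  set b := (h : ℝ) / 2 ^ (R - 1) with hb
  have hab : a ≤ b := by rw [ha, hb]; gcongr; linarith
  have hsub : Set.Icc a b ⊆ I01 := by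
    refine Set.Icc_subset_Icc (div_nonneg (by linarith) hp.le) ?_
    rw [hb, div_le_one hp]; exact h2
  have hmul : (fun t => wavelet R h g t * wavelet R h g' t) = (Set.Icc a b).indicator (fun t =>
      √((g : ℝ) + 1 / 2) * √((g' : ℝ) + 1 / 2) * 2 ^ R *
        (legendre g * legendre g').eval (2 ^ R * t + (1 - 2 * h))) := by
    have h2R : (2 : ℝ) ^ ((R : ℝ) / 2) * (2 : ℝ) ^ ((R : ℝ) / 2) = 2 ^ R := by
      rw [← Real.rpow_add two_pos, add_halves, Real.rpow_natCast]
    ext t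
    simp only [wavelet_eq_indicator, ← ha, ← hb, Set.indicator_apply]
    split_ifs
    · rw [eval_mul, show (2 : ℝ) ^ R * t - 2 * h + 1 = 2 ^ R * t + (1 - 2 * h) by ring]
      linear_combination (√((g : ℝ) + 1 / 2) * √((g' : ℝ) + 1 / 2) *
        (legendre g).eval (2 ^ R * t + (1 - 2 * h)) *
          (legendre g').eval (2 ^ R * t + (1 - 2 * h))) * h2R
    · simp
  rw [hmul, integral_indicator measurableSet_Icc, unitMeasure,
    Measure.restrict_restrict measurableSet_Icc, Set.inter_eq_left.2 hsub,
    integral_Icc_eq_integral_Ioc, ← intervalIntegral.integral_of_le hab,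
    intervalIntegral.integral_const_mul,
    intervalIntegral.integral_comp_mul_add (fun x => (legendre g * legendre g').eval x)
      (by positivity),
    show (2 : ℝ) ^ R * a + (1 - 2 * h) = -1 by rw [ha, hpow]; field_simp; ring,
    show (2 : ℝ) ^ R * b + (1 - 2 * h) = 1 by rw [hb, hpow]; field_simp; ring,
    ← polyIntegral_apply, polyIntegral_legendre_mul_legendre, smul_eq_mul]
  split_ifs with hg
  · subst hg
    rw [Real.mul_self_sqrt (by positivity)]
    field_simp
  · simp

theorem integral_wavelet_mul {R h h' : ℕ} (hR : 1 ≤ R) (hh : h ∈ Finset.Icc 1 (2 ^ (R - 1)))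
    (g g' : ℕ) : ∫ t, wavelet R h g t * wavelet R h' g' t ∂unitMeasure =
      if h = h' ∧ g = g' then 1 else 0 := by
  rcases lt_trichotomy h h' with hlt | rfl | hlt
  · rw [integral_wavelet_mul_of_lt hlt, if_neg (by omega)]
  · simp [integral_wavelet_mul_self hR hh]
  · simp only [mul_comm (wavelet R h g _)]
    rw [integral_wavelet_mul_of_lt hlt, if_neg (by omega)]

/-! ### The truncated wavelet expansion as an orthogonal projection -/

/-- The tensor product wavelet with index `(h, g, h', g')`. -/
noncomputable def tensorWavelet (R R' : ℕ) (i : ℕ × ℕ × ℕ × ℕ) (z : ℝ × ℝ) : ℝ :=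
  wavelet R i.1 i.2.1 z.1 * wavelet R' i.2.2.1 i.2.2.2 z.2

theorem memLp_tensorWavelet (R R' : ℕ) (i : ℕ × ℕ × ℕ × ℕ) :
    MemLp (tensorWavelet R R' i) 2 squareMeasure := by
  obtain ⟨C, hC⟩ := exists_wavelet_bound R i.1 i.2.1
  obtain ⟨C', hC'⟩ := exists_wavelet_bound R' i.2.2.1 i.2.2.2
  refine MemLp.of_bound (((measurable_wavelet R i.1 i.2.1).comp measurable_fst).mul
    ((measurable_wavelet R' i.2.2.1 i.2.2.2).comp measurable_snd)).aestronglyMeasurable (C * C') ?_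
  refine Eventually.of_forall fun z => ?_
  rw [tensorWavelet, Real.norm_eq_abs, abs_mul]
  exact mul_le_mul (hC _) (hC' _) (abs_nonneg _) ((abs_nonneg _).trans (hC z.1))

/-- The index set of the truncated wavelet expansion. -/
def waveletIndices (R R' Λ Λ' : ℕ) : Finset (ℕ × ℕ × ℕ × ℕ) :=
  Finset.Icc 1 (2 ^ (R - 1)) ×ˢ Finset.range Λ ×ˢ Finset.Icc 1 (2 ^ (R' - 1)) ×ˢ Finset.range Λ'

theorem integral_tensorWavelet_mul {R R' Λ Λ' : ℕ} (hR : 1 ≤ R) (hR' : 1 ≤ R')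
    {i j : ℕ × ℕ × ℕ × ℕ} (hi : i ∈ waveletIndices R R' Λ Λ') :
    ∫ z, tensorWavelet R R' i z * tensorWavelet R R' j z ∂squareMeasure =
      if i = j then 1 else 0 := by
  simp only [waveletIndices, Finset.mem_product] at hi
  have : ∀ z, tensorWavelet R R' i z * tensorWavelet R R' j z =
      (wavelet R i.1 i.2.1 z.1 * wavelet R j.1 j.2.1 z.1) *
        (wavelet R' i.2.2.1 i.2.2.2 z.2 * wavelet R' j.2.2.1 j.2.2.2 z.2) := fun z => by
    rw [tensorWavelet, tensorWavelet]; ring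
  simp only [this]
  rw [squareMeasure, integral_prod_mul
    (fun x => wavelet R i.1 i.2.1 x * wavelet R j.1 j.2.1 x)
    (fun t => wavelet R' i.2.2.1 i.2.2.2 t * wavelet R' j.2.2.1 j.2.2.2 t),
    integral_wavelet_mul hR hi.1, integral_wavelet_mul hR' hi.2.2.1]
  obtain ⟨i1, i2, i3, i4⟩ := i
  obtain ⟨j1, j2, j3, j4⟩ := j
  simp only [Prod.mk.injEq]
  split_ifs <;> first | (exfalso; omega) | simp

theorem trunc_eq_sum (R R' Λ Λ' : ℕ) (F : ℝ → ℝ → ℝ) (x t : ℝ) :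
    trunc R R' Λ Λ' F x t = ∑ i ∈ waveletIndices R R' Λ Λ',
      waveletCoeff R R' F i.1 i.2.1 i.2.2.1 i.2.2.2 * tensorWavelet R R' i (x, t) := by
  simp only [trunc, waveletIndices, Finset.sum_product, tensorWavelet]

theorem integrable_mul_tensorWavelet {F : ℝ → ℝ → ℝ} (hF : SquareContinuous F) (R R' : ℕ)
    (i : ℕ × ℕ × ℕ × ℕ) :
    Integrable (fun z => F z.1 z.2 * tensorWavelet R R' i z) squareMeasure :=
  hF.memLp.integrable_mul (memLp_tensorWavelet R R' i)

theorem waveletCoeff_eq {F : ℝ → ℝ → ℝ} (hF : SquareContinuous F) (R R' : ℕ)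
    (i : ℕ × ℕ × ℕ × ℕ) : waveletCoeff R R' F i.1 i.2.1 i.2.2.1 i.2.2.2 =
      ∫ z, F z.1 z.2 * tensorWavelet R R' i z ∂squareMeasure :=
  intervalIntegral_eq_squareMeasure
    (F := fun x t => F x t * (wavelet R i.1 i.2.1 x * wavelet R' i.2.2.1 i.2.2.2 t))
    (integrable_mul_tensorWavelet hF R R' i)

/-- Continuity supplies the integrability that makes the coefficients integrals over the square, and
additive. -/
theorem trunc_add {F G : ℝ → ℝ → ℝ} (hF : SquareContinuous F) (hG : SquareContinuous G)
    (R R' Λ Λ' : ℕ) (x t : ℝ) : trunc R R' Λ Λ' (fun x t => F x t + G x t) x t =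
      trunc R R' Λ Λ' F x t + trunc R R' Λ Λ' G x t := by
  simp only [trunc_eq_sum, ← Finset.sum_add_distrib, ← add_mul]
  refine Finset.sum_congr rfl fun i _ => ?_
  rw [waveletCoeff_eq hF, waveletCoeff_eq hG, waveletCoeff_eq (hF.add hG), ← integral_add
    (integrable_mul_tensorWavelet hF R R' i) (integrable_mul_tensorWavelet hG R R' i)]
  simp only [add_mul]

theorem trunc_const_mul {F : ℝ → ℝ → ℝ} (hF : SquareContinuous F) (c : ℝ)
    (R R' Λ Λ' : ℕ) (x t : ℝ) : trunc R R' Λ Λ' (fun x t => c * F x t) x t =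
      c * trunc R R' Λ Λ' F x t := by
  simp only [trunc_eq_sum, Finset.mul_sum, ← mul_assoc]
  refine Finset.sum_congr rfl fun i _ => ?_
  rw [waveletCoeff_eq hF, waveletCoeff_eq (continuousOn_const.mul hF), ← integral_const_mul]
  simp only [mul_assoc]

theorem trunc_sub {F G : ℝ → ℝ → ℝ} (hF : SquareContinuous F) (hG : SquareContinuous G)
    (R R' Λ Λ' : ℕ) (x t : ℝ) : trunc R R' Λ Λ' (fun x t => F x t - G x t) x t =
      trunc R R' Λ Λ' F x t - trunc R R' Λ Λ' G x t := by
  have h : SquareContinuous fun x t => (-1) * G x t := continuousOn_const.mul hG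
  rw [sub_eq_add_neg, ← neg_one_mul, ← trunc_const_mul hG, ← trunc_add hF h]
  simp only [neg_one_mul, sub_eq_add_neg]

theorem trunc_sum {s : Finset ℝ} {F : ℝ → ℝ → ℝ → ℝ} (hF : ∀ τ ∈ s, SquareContinuous (F τ))
    (R R' Λ Λ' : ℕ) (x t : ℝ) : trunc R R' Λ Λ' (fun x t => ∑ τ ∈ s, F τ x t) x t =
      ∑ τ ∈ s, trunc R R' Λ Λ' (F τ) x t := by
  simp only [trunc_eq_sum]
  rw [Finset.sum_comm]
  refine Finset.sum_congr rfl fun i _ => ?_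
  rw [← Finset.sum_mul, waveletCoeff_eq (F := fun x t => ∑ τ ∈ s, F τ x t)
    (continuousOn_finsetSum s hF), Finset.sum_congr rfl fun τ hτ => waveletCoeff_eq (hF τ hτ) R R' i,
    ← integral_finsetSum _ fun τ hτ => integrable_mul_tensorWavelet (hF τ hτ) R R' i]
  simp only [Finset.sum_mul]

theorem l2Norm_trunc_le {F : ℝ → ℝ → ℝ} (hF : SquareContinuous F) {R R' : ℕ} (hR : 1 ≤ R)
    (hR' : 1 ≤ R') (Λ Λ' : ℕ) :
    l2Norm (trunc R R' Λ Λ' F) ≤ √(∫ z, F z.1 z.2 ^ 2 ∂squareMeasure) := by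
  refine Real.sqrt_le_sqrt ?_
  have hT : MemLp (fun z : ℝ × ℝ => trunc R R' Λ Λ' F z.1 z.2) 2 squareMeasure := by
    simp only [trunc_eq_sum]
    exact memLp_finsetSum _ fun i _ => (memLp_tensorWavelet R R' i).const_mul _
  simp only [sq_abs]
  rw [intervalIntegral_eq_squareMeasure (F := fun x t => trunc R R' Λ Λ' F x t ^ 2)
    hT.integrable_sq]
  simp only [trunc_eq_sum, waveletCoeff_eq hF]
  exact integral_sq_sum_le (fun i _ => memLp_tensorWavelet R R' i) hF.memLp
    fun i hi j _ => integral_tensorWavelet_mul hR hR' hi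

theorem sqrt_integral_sq_le {F : ℝ → ℝ → ℝ} {δ : ℝ}
    (h : ∀ x ∈ I01, ∀ t ∈ I01, |F x t| ≤ δ) :
    √(∫ z, F z.1 z.2 ^ 2 ∂squareMeasure) ≤ δ := by
  have hδ : 0 ≤ δ := (abs_nonneg _).trans
    (h 0 (Set.left_mem_Icc.2 zero_le_one) 0 (Set.left_mem_Icc.2 zero_le_one))
  rw [Real.sqrt_le_left hδ]
  have h1 : ∀ᵐ z ∂squareMeasure, ‖F z.1 z.2 ^ 2‖ ≤ δ ^ 2 := by
    filter_upwards [ae_mem_square] with z hz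
    rw [norm_pow]
    exact pow_le_pow_left₀ (norm_nonneg _) (h z.1 hz.1 z.2 hz.2) 2
  have := norm_integral_le_of_norm_le_const h1
  rw [squareMeasure_real_univ, mul_one] at this
  exact (Real.le_norm_self _).trans this

/-! ### Continuity of Caputo derivatives and of weakly singular integrals -/

theorem intervalIntegrable_one_sub_rpow {e : ℝ} (he : -1 < e) :
    IntervalIntegrable (fun s : ℝ => (1 - s) ^ e) volume 0 1 := by
  have h := (intervalIntegral.intervalIntegrable_rpow' (a := 0) (b := 1) he).comp_sub_left 1
  simpa using h.symm

/-- Substituting `τ = t s` fixes both the limits and the singularity of the kernel, so that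
dependence on `t` can be studied by dominated convergence. -/
theorem integral_abel_eq {e t : ℝ} (he : -1 < e) (ht : 0 ≤ t) (G : ℝ → ℝ) :
    ∫ τ in (0 : ℝ)..t, (t - τ) ^ e * G τ =
      t ^ (e + 1) * ∫ s in (0 : ℝ)..1, (1 - s) ^ e * G (t * s) := by
  rcases ht.eq_or_lt with rfl | hpos
  · rw [intervalIntegral.integral_same, Real.zero_rpow (by linarith), zero_mul]
  · have h := intervalIntegral.integral_comp_mul_left (a := 0) (b := 1)
      (fun τ => (t - τ) ^ e * G τ) hpos.ne'
    rw [mul_zero, mul_one, smul_eq_mul, eq_inv_mul_iff_mul_eq₀ hpos.ne'] at h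
    rw [← h, Real.rpow_add_one hpos.ne', mul_comm (t ^ e) t, mul_assoc,
      ← intervalIntegral.integral_const_mul (t ^ e)]
    congr 1
    refine intervalIntegral.integral_congr fun s hs => ?_
    rw [Set.uIcc_of_le zero_le_one] at hs
    rw [show t - t * s = t * (1 - s) by ring, Real.mul_rpow hpos.le (sub_nonneg.2 hs.2), mul_assoc]

/-- One statement covers the three kernels, with `e = -α`, `e = 1 - β` and `e = -1/2`. The majorant
is `C |(1 - s)^e|`. -/
theorem squareContinuous_abel {e : ℝ} (he : -1 < e) {G : ℝ → ℝ → ℝ} (hG : SquareContinuous G) :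
    SquareContinuous fun x t => ∫ τ in (0 : ℝ)..t, (t - τ) ^ e * G x τ := by
  obtain ⟨C, hC⟩ := hG.exists_bound
  have hmap : ∀ p ∈ I01 ×ˢ I01, ∀ s ∈ I01, ((p.1, p.2 * s) : ℝ × ℝ) ∈ I01 ×ˢ I01 :=
    fun p hp s hs => ⟨hp.1, mul_nonneg hp.2.1 hs.1, mul_le_one₀ hp.2.2 hs.1 hs.2⟩
  have hcont : ContinuousOn (fun p : ℝ × ℝ =>
      ∫ s, (1 - s) ^ e * G p.1 (p.2 * s) ∂unitMeasure) (I01 ×ˢ I01) := by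
    refine continuousOn_of_dominated (bound := fun s => |(1 - s) ^ e| * C) (fun p hp => ?_)
      (fun p hp => ?_) ?_ ?_
    · refine AEStronglyMeasurable.mul
        (Measurable.aestronglyMeasurable (by fun_prop)) ?_
      refine ContinuousOn.aestronglyMeasurable ?_ measurableSet_Icc
      exact ContinuousOn.comp hG (f := fun s : ℝ => ((p.1, p.2 * s) : ℝ × ℝ)) (by fun_prop)
        fun s hs => hmap p hp s hs
    · refine ae_restrict_of_forall_mem measurableSet_Icc fun s hs => ?_
      rw [norm_mul, Real.norm_eq_abs]
      have hm := hmap p hp s hs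
      exact mul_le_mul_of_nonneg_left (hC _ hm.1 _ hm.2) (abs_nonneg _)
    · have h := intervalIntegrable_one_sub_rpow he
      rw [intervalIntegrable_iff_integrableOn_Icc_of_le zero_le_one] at h
      exact Integrable.mul_const (Integrable.abs h) C
    · refine ae_restrict_of_forall_mem measurableSet_Icc fun s hs => ?_
      exact continuousOn_const.mul
        (ContinuousOn.comp hG (f := fun p : ℝ × ℝ => ((p.1, p.2 * s) : ℝ × ℝ)) (by fun_prop)
          fun p hp => hmap p hp s hs)
  have hpow : ContinuousOn (fun p : ℝ × ℝ => p.2 ^ (e + 1)) (I01 ×ˢ I01) :=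
    (continuous_snd.rpow_const fun _ => Or.inr (by linarith)).continuousOn
  refine (hpow.mul hcont).congr fun p hp => ?_
  simp only
  rw [integral_abel_eq he hp.2.1, intervalIntegral_eq_unitMeasure]
  rfl

theorem SquareContinuous.swap {F : ℝ → ℝ → ℝ} (hF : SquareContinuous F) :
    SquareContinuous fun x t => F t x :=
  ContinuousOn.comp hF (f := Prod.swap) continuous_swap.continuousOn fun _ hp => ⟨hp.2, hp.1⟩

theorem caputo_eq_of_mem_Ioo {n : ℕ} {α : ℝ} (hα : α ∈ Set.Ioo (n : ℝ) (n + 1)) (u : ℝ → ℝ)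
    (t : ℝ) : caputo α u t = 1 / Real.Gamma (n + 1 - α) *
      ∫ τ in (0 : ℝ)..t, (t - τ) ^ ((n : ℝ) - α) * iteratedDerivWithin (n + 1) u I01 τ := by
  have hc : ⌈α⌉₊ = n + 1 := by
    rw [Nat.ceil_eq_iff (Nat.succ_ne_zero n)]
    push_cast
    exact ⟨by simpa using hα.1, hα.2.le⟩
  rw [caputo, if_neg, hc]
  · push_cast
    simp only [add_sub_cancel_right]
  · rw [hc]
    push_cast
    exact hα.2.ne

theorem squareContinuous_caputoT {U : ℝ → ℝ → ℝ} (hU : SquareContinuous (dT 1 U)) {α : ℝ}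
    (hα : α ∈ Set.Ioo (0 : ℝ) 1) : SquareContinuous (caputoT α U) := by
  have h : ∀ x t, caputoT α U x t = 1 / Real.Gamma (1 - α) *
      ∫ τ in (0 : ℝ)..t, (t - τ) ^ (-α) * dT 1 U x τ := fun x t => by
    rw [caputoT, caputo_eq_of_mem_Ioo (n := 0) (by simpa using hα)]
    simp [dT]
  simp only [SquareContinuous, h]
  exact continuousOn_const.mul (squareContinuous_abel (by linarith [hα.2]) hU)

theorem squareContinuous_caputoX {U : ℝ → ℝ → ℝ} (hU : SquareContinuous (dX 2 U)) {β : ℝ}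
    (hβ : β ∈ Set.Ioo (1 : ℝ) 2) : SquareContinuous (caputoX β U) := by
  have h : ∀ x t, caputoX β U x t = 1 / Real.Gamma (2 - β) *
      ∫ τ in (0 : ℝ)..x, (x - τ) ^ (1 - β) * dX 2 U τ t := fun x t => by
    have hβ' : β ∈ Set.Ioo ((1 : ℕ) : ℝ) ((1 : ℕ) + 1) := by
      norm_num
      exact hβ
    rw [caputoX, caputo_eq_of_mem_Ioo hβ']
    norm_num [dX]
  simp only [SquareContinuous, h]
  exact continuousOn_const.mul
    (squareContinuous_abel (e := 1 - β) (by linarith [hβ.2]) hU.swap).swap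

theorem squareContinuous_singularIntegral {U : ℝ → ℝ → ℝ} (hU : SquareContinuous (dX 2 U)) :
    SquareContinuous (singularIntegral U) :=
  squareContinuous_abel (by norm_num) hU

/-! ### The wavelet tail sum -/

theorem tailSum_eq (R R' Λ Λ' : ℕ) : tailSum R R' Λ Λ' =
    1 / 256 * (∑' i : ℕ, 1 / ((i + (2 ^ (R - 1) + 1) : ℕ) : ℝ) ^ 5) *
      (∑' j : ℕ, 1 / (2 * ((j + Λ : ℕ) : ℝ) - 3) ^ 4) *
      (∑' i : ℕ, 1 / ((i + (2 ^ (R' - 1) + 1) : ℕ) : ℝ) ^ 5) *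
      ∑' j : ℕ, 1 / (2 * ((j + Λ' : ℕ) : ℝ) - 3) ^ 4 := by
  have h : ∀ i j i' j' : ℕ,
      1 / (256 * (((2 ^ (R - 1) + 1 + i : ℕ) : ℝ) * ((2 ^ (R' - 1) + 1 + i' : ℕ) : ℝ)) ^ 5
        * (2 * ((Λ + j : ℕ) : ℝ) - 3) ^ 4 * (2 * ((Λ' + j' : ℕ) : ℝ) - 3) ^ 4) =
      1 / 256 * (1 / ((i + (2 ^ (R - 1) + 1) : ℕ) : ℝ) ^ 5) *
        (1 / (2 * ((j + Λ : ℕ) : ℝ) - 3) ^ 4) * (1 / ((i' + (2 ^ (R' - 1) + 1) : ℕ) : ℝ) ^ 5) *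
        (1 / (2 * ((j' + Λ' : ℕ) : ℝ) - 3) ^ 4) := fun i j i' j' => by
    simp only [add_comm i, add_comm j, add_comm i', add_comm j', one_div, mul_inv, mul_pow]
    ring
  simp only [tailSum, h, tsum_mul_left, tsum_mul_right]

theorem tendsto_tailSum : Tendsto (fun n : ℕ × ℕ × ℕ × ℕ => tailSum n.1 n.2.1 n.2.2.1 n.2.2.2)
    atTop (𝓝 0) := by
  have hA : Tendsto (fun R : ℕ => ∑' i : ℕ, 1 / ((i + (2 ^ (R - 1) + 1) : ℕ) : ℝ) ^ 5)
      atTop (𝓝 0) := by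
    refine (tendsto_sum_nat_add (fun k : ℕ => 1 / (k : ℝ) ^ 5)).comp
      (g := fun n => ∑' i : ℕ, 1 / ((i + n : ℕ) : ℝ) ^ 5)
      (f := fun R : ℕ => 2 ^ (R - 1) + 1) ?_
    refine (tendsto_add_atTop_nat 1).comp ?_
    exact (tendsto_pow_atTop_atTop_of_one_lt one_lt_two).comp (tendsto_sub_atTop_nat 1)
  have hB : Tendsto (fun Λ : ℕ => ∑' j : ℕ, 1 / (2 * ((j + Λ : ℕ) : ℝ) - 3) ^ 4) atTop (𝓝 0) :=
    tendsto_sum_nat_add (fun k : ℕ => 1 / (2 * (k : ℝ) - 3) ^ 4)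
  have t1 : Tendsto (fun n : ℕ × ℕ × ℕ × ℕ => n.1) atTop atTop := by
    rw [← prod_atTop_atTop_eq]; exact tendsto_fst
  have t2 : Tendsto (fun n : ℕ × ℕ × ℕ × ℕ => n.2) atTop atTop := by
    rw [← prod_atTop_atTop_eq]; exact tendsto_snd
  have t3 : Tendsto (fun n : ℕ × ℕ × ℕ => n.1) atTop atTop := by
    rw [← prod_atTop_atTop_eq]; exact tendsto_fst
  have t4 : Tendsto (fun n : ℕ × ℕ × ℕ => n.2) atTop atTop := by
    rw [← prod_atTop_atTop_eq]; exact tendsto_snd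
  have t5 : Tendsto (fun n : ℕ × ℕ => n.1) atTop atTop := by
    rw [← prod_atTop_atTop_eq]; exact tendsto_fst
  have t6 : Tendsto (fun n : ℕ × ℕ => n.2) atTop atTop := by
    rw [← prod_atTop_atTop_eq]; exact tendsto_snd
  have hlim := (((tendsto_const_nhds (x := (1 / 256 : ℝ))).mul (hA.comp t1)).mul
    (hB.comp (t5.comp (t4.comp t2)))).mul (hA.comp (t3.comp t2)) |>.mul
      (hB.comp (t6.comp (t4.comp t2)))
  simp only [mul_zero] at hlim
  exact hlim.congr fun n => (tailSum_eq _ _ _ _).symm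

/-! ### The residual as the projection of the quadrature error -/

/-- The operator `L₁` with the integrals over the orders replaced by Legendre-Gauss quadrature. -/
noncomputable def discretizedOperator (ρ₁ ρ₂ : ℝ → ℝ) (κ : ℝ) (f U : ℝ → ℝ → ℝ) (P Q : ℕ)
    (x t : ℝ) : ℝ :=
  quadrature 0 1 P (H₁ ρ₁ U x t) + U x t - κ * quadrature 1 2 Q (H₂ ρ₂ U x t)
    - singularIntegral U x t - f x t

section

variable {ρ₁ ρ₂ : ℝ → ℝ} {κ : ℝ} {f U : ℝ → ℝ → ℝ}

theorem squareContinuous_quadrature_H₁ (hUt : SquareContinuous (dT 1 U)) (P : ℕ) :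
    SquareContinuous fun x t => quadrature 0 1 P (H₁ ρ₁ U x t) :=
  continuousOn_finsetSum _ fun _ hτ => continuousOn_const.mul (continuousOn_const.mul
    (squareContinuous_caputoT hUt (qNode_mem_Ioo one_pos hτ)))

theorem squareContinuous_quadrature_H₂ (hUxx : SquareContinuous (dX 2 U)) (Q : ℕ) :
    SquareContinuous fun x t => quadrature 1 2 Q (H₂ ρ₂ U x t) :=
  continuousOn_finsetSum _ fun _ hτ => continuousOn_const.mul (continuousOn_const.mul
    (squareContinuous_caputoX hUxx (qNode_mem_Ioo one_lt_two hτ)))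

theorem squareContinuous_discretizedOperator (hU : SquareContinuous U)
    (hUt : SquareContinuous (dT 1 U)) (hUxx : SquareContinuous (dX 2 U))
    (hf : SquareContinuous f) (P Q : ℕ) :
    SquareContinuous (discretizedOperator ρ₁ ρ₂ κ f U P Q) :=
  ((((squareContinuous_quadrature_H₁ hUt P).add hU).sub
    (continuousOn_const.mul (squareContinuous_quadrature_H₂ hUxx Q))).sub
      (squareContinuous_singularIntegral hUxx)).sub hf

theorem residual_eq_trunc (hU : SquareContinuous U) (hUt : SquareContinuous (dT 1 U))
    (hUxx : SquareContinuous (dX 2 U)) (hf : SquareContinuous f) (P Q R R' Λ Λ' : ℕ) :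
    residual ρ₁ ρ₂ κ f U P Q R R' Λ Λ' =
      trunc R R' Λ Λ' (discretizedOperator ρ₁ ρ₂ κ f U P Q) := by
  have c1 := squareContinuous_quadrature_H₁ (ρ₁ := ρ₁) hUt P
  have c2 := squareContinuous_quadrature_H₂ (ρ₂ := ρ₂) hUxx Q
  have c2' : SquareContinuous fun x t => κ * quadrature 1 2 Q (H₂ ρ₂ U x t) :=
    continuousOn_const.mul c2
  have c3 := squareContinuous_singularIntegral hUxx
  have e1 : ∀ x t, trunc R R' Λ Λ' (fun x t => quadrature 0 1 P (H₁ ρ₁ U x t)) x t =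
      ∑ τ ∈ nodes P, qWeight 0 1 P τ * ρ₁ (qNode 0 1 τ) *
        trunc R R' Λ Λ' (caputoT (qNode 0 1 τ) U) x t := fun x t => by
    have hc : ∀ τ ∈ nodes P, SquareContinuous (caputoT (qNode 0 1 τ) U) := fun τ hτ =>
      squareContinuous_caputoT hUt (qNode_mem_Ioo one_pos hτ)
    simp only [quadrature, H₁, ← mul_assoc]
    rw [trunc_sum (F := fun τ x t => qWeight 0 1 P τ * ρ₁ (qNode 0 1 τ) * caputoT (qNode 0 1 τ) U x t)
      fun τ hτ => continuousOn_const.mul (hc τ hτ)]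
    exact Finset.sum_congr rfl fun τ hτ => trunc_const_mul (hc τ hτ) _ _ _ _ _ _ _
  have e2 : ∀ x t, trunc R R' Λ Λ' (fun x t => quadrature 1 2 Q (H₂ ρ₂ U x t)) x t =
      ∑ τ ∈ nodes Q, qWeight 1 2 Q τ * ρ₂ (qNode 1 2 τ) *
        trunc R R' Λ Λ' (caputoX (qNode 1 2 τ) U) x t := fun x t => by
    have hc : ∀ τ ∈ nodes Q, SquareContinuous (caputoX (qNode 1 2 τ) U) := fun τ hτ =>
      squareContinuous_caputoX hUxx (qNode_mem_Ioo one_lt_two hτ)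
    simp only [quadrature, H₂, ← mul_assoc]
    rw [trunc_sum (F := fun τ x t => qWeight 1 2 Q τ * ρ₂ (qNode 1 2 τ) * caputoX (qNode 1 2 τ) U x t)
      fun τ hτ => continuousOn_const.mul (hc τ hτ)]
    exact Finset.sum_congr rfl fun τ hτ => trunc_const_mul (hc τ hτ) _ _ _ _ _ _ _
  ext x t
  unfold discretizedOperator
  rw [trunc_sub (((c1.add hU).sub c2').sub c3) hf, trunc_sub ((c1.add hU).sub c2') c3,
    trunc_sub (c1.add hU) c2', trunc_add c1 hU, trunc_const_mul c2, e1, e2]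
  rfl

theorem discretizedOperator_eq_of_L₁_eq_zero {x t : ℝ} (h : L₁ ρ₁ ρ₂ κ f U x t = 0) (P Q : ℕ) :
    discretizedOperator ρ₁ ρ₂ κ f U P Q x t =
      (quadrature 0 1 P (H₁ ρ₁ U x t) - ∫ α in (0 : ℝ)..1, H₁ ρ₁ U x t α) -
        κ * (quadrature 1 2 Q (H₂ ρ₂ U x t) - ∫ β in (1 : ℝ)..2, H₂ ρ₂ U x t β) := by
  rw [L₁] at h
  rw [discretizedOperator]
  linarith

theorem OrderRegular.abs_iteratedDeriv_le {a b : ℝ} {m : ℕ} {H : ℝ → ℝ → ℝ → ℝ}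
    (hH : OrderRegular a b m H) {x t : ℝ} (hx : x ∈ I01) (ht : t ∈ I01) :
    ∀ γ ∈ Set.Ioo a b, |iteratedDeriv (2 * m) (H x t) γ| ≤ orderConst a b m H :=
  fun γ hγ => le_csSup hH.bddAbove ⟨x, hx, t, ht, γ, hγ, rfl⟩

/-- No boundedness is needed, since `sSup` of an unbounded set of reals is `0`. -/
theorem orderConst_nonneg (a b : ℝ) (m : ℕ) (H : ℝ → ℝ → ℝ → ℝ) : 0 ≤ orderConst a b m H :=
  Real.sSup_nonneg fun _ ⟨_, _, _, _, _, _, h⟩ => h ▸ abs_nonneg _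

theorem OrderRegular.abs_quadrature_sub_integral_le {a b : ℝ} (hab : b = a + 1) {m P : ℕ}
    (hm : 1 ≤ m) (hmP : m ≤ P) {H : ℝ → ℝ → ℝ → ℝ} (hH : OrderRegular a b m H) {x t : ℝ}
    (hx : x ∈ I01) (ht : t ∈ I01) :
    |quadrature a b P (H x t) - ∫ γ in a..b, H x t γ| ≤ 2 * orderConst a b m H / 4 ^ m :=
  abs_quadrature_sub_integral_le_of_contDiffOn hab hm hmP (hH.contDiffOn x hx t ht)
    (hH.abs_iteratedDeriv_le hx ht)

theorem OrderRegular.tendsto_quadrature_sub_integral {a b : ℝ} (hab : a < b)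
    {H : ℝ → ℝ → ℝ → ℝ} (hH : OrderRegular a b 1 H) {x t : ℝ} (hx : x ∈ I01) (ht : t ∈ I01) :
    Tendsto (fun P => quadrature a b P (H x t) - ∫ γ in a..b, H x t γ) atTop (𝓝 0) := by
  have h := tendsto_quadrature hab (f := H x t) (by simpa using hH.contDiffOn x hx t ht)
    (hH.abs_iteratedDeriv_le hx ht)
  simpa using h.sub_const (∫ γ in a..b, H x t γ)

theorem abs_discretizedOperator_le (hsol : ∀ x ∈ I01, ∀ t ∈ I01, L₁ ρ₁ ρ₂ κ f U x t = 0)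
    {m n P Q : ℕ} (hm : 1 ≤ m) (hn : 1 ≤ n) (hmP : m ≤ P) (hnQ : n ≤ Q)
    (hH₁ : OrderRegular 0 1 m (H₁ ρ₁ U)) (hH₂ : OrderRegular 1 2 n (H₂ ρ₂ U)) {x t : ℝ}
    (hx : x ∈ I01) (ht : t ∈ I01) : |discretizedOperator ρ₁ ρ₂ κ f U P Q x t| ≤
      2 * orderConst 0 1 m (H₁ ρ₁ U) / 4 ^ m + |κ| * (2 * orderConst 1 2 n (H₂ ρ₂ U) / 4 ^ n) := by
  rw [discretizedOperator_eq_of_L₁_eq_zero (hsol x hx t ht)]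
  refine (abs_sub _ _).trans (add_le_add
    (hH₁.abs_quadrature_sub_integral_le (by norm_num) hm hmP hx ht) ?_)
  rw [abs_mul]
  exact mul_le_mul_of_nonneg_left
    (hH₂.abs_quadrature_sub_integral_le (by norm_num) hn hnQ hx ht) (abs_nonneg κ)

/-- Pointwise convergence suffices, because the bound with `m = n = 1` holds for all `P, Q ≥ 1` and
gives the constant majorant `M²`. -/
theorem tendsto_integral_discretizedOperator_sq (hU : SquareContinuous U)
    (hUt : SquareContinuous (dT 1 U)) (hUxx : SquareContinuous (dX 2 U))
    (hf : SquareContinuous f) (hsol : ∀ x ∈ I01, ∀ t ∈ I01, L₁ ρ₁ ρ₂ κ f U x t = 0)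
    (hH₁ : OrderRegular 0 1 1 (H₁ ρ₁ U)) (hH₂ : OrderRegular 1 2 1 (H₂ ρ₂ U)) :
    Tendsto (fun n : ℕ × ℕ => ∫ z, discretizedOperator ρ₁ ρ₂ κ f U n.1 n.2 z.1 z.2 ^ 2
      ∂squareMeasure) atTop (𝓝 0) := by
  set M := 2 * orderConst 0 1 1 (H₁ ρ₁ U) / 4 ^ 1 +
    |κ| * (2 * orderConst 1 2 1 (H₂ ρ₂ U) / 4 ^ 1) with hM
  rw [← integral_zero (ℝ × ℝ) ℝ (μ := squareMeasure)]
  refine tendsto_integral_filter_of_dominated_convergence (fun _ => M ^ 2)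
    (Eventually.of_forall fun n => ?_) ?_ (integrable_const _) ?_
  · exact ((squareContinuous_discretizedOperator hU hUt hUxx hf n.1 n.2).memLp.integrable_sq).1
  · filter_upwards [eventually_ge_atTop ((1, 1) : ℕ × ℕ)] with n hn
    filter_upwards [ae_mem_square] with z hz
    rw [norm_pow]
    exact pow_le_pow_left₀ (norm_nonneg _)
      (abs_discretizedOperator_le hsol le_rfl le_rfl hn.1 hn.2 hH₁ hH₂ hz.1 hz.2) 2
  · filter_upwards [ae_mem_square] with z hz
    have l1 := hH₁.tendsto_quadrature_sub_integral one_pos hz.1 hz.2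
    have l2 := hH₂.tendsto_quadrature_sub_integral one_lt_two hz.1 hz.2
    rw [← prod_atTop_atTop_eq]
    have h := ((l1.comp tendsto_fst).sub ((l2.comp tendsto_snd).const_mul κ)).pow 2
    simp only [mul_zero, sub_zero, ne_eq, OfNat.ofNat_ne_zero, not_false_eq_true, zero_pow] at h
    refine h.congr fun n => ?_
    rw [discretizedOperator_eq_of_L₁_eq_zero (hsol z.1 hz.1 z.2 hz.2)]
    rfl

end

/-! ### Signs of the constants, and the main theorem -/

theorem BoundedMixed.nonneg {H : ℝ → ℝ → ℝ} {B : ℝ} (h : BoundedMixed H B) : 0 ≤ B :=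
  (abs_nonneg _).trans (h.bound 0 (Set.left_mem_Icc.2 zero_le_one) 0
    (Set.left_mem_Icc.2 zero_le_one))

theorem maxWeight_nonneg (a b : ℝ) (P : ℕ) : 0 ≤ maxWeight a b P :=
  Real.sSup_nonneg fun _ ⟨_, _, h⟩ => h ▸ abs_nonneg _

theorem maxAtNodes_nonneg (a b : ℝ) (P : ℕ) (ρ : ℝ → ℝ) : 0 ≤ maxAtNodes a b P ρ :=
  Real.sSup_nonneg fun _ ⟨_, _, h⟩ => h ▸ abs_nonneg _

end DistributedOrder

open DistributedOrder

theorem mainTheorem4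
    (ρ₁ ρ₂ : ℝ → ℝ) (κ : ℝ) (f U : ℝ → ℝ → ℝ) (B B₀ B₁ B₂ : ℝ)
    (hUx : ∀ t ∈ DistributedOrder.I01, DistributedOrder.TwiceDiff (fun x => U x t))
    (hU : DistributedOrder.BoundedMixed U B₀)
    (hUt : DistributedOrder.BoundedMixed (DistributedOrder.dT 1 U) B₁)
    (hUxx : DistributedOrder.BoundedMixed (DistributedOrder.dX 2 U) B₂)
    (hf : DistributedOrder.BoundedMixed f B)
    (hsol : ∀ x ∈ DistributedOrder.I01, ∀ t ∈ DistributedOrder.I01,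
      DistributedOrder.L₁ ρ₁ ρ₂ κ f U x t = 0) :
    -- the residual bound
    (∀ P Q : ℕ, 1 ≤ P → 1 ≤ Q →
      DistributedOrder.OrderRegular 0 1 P (DistributedOrder.H₁ ρ₁ U) →
      DistributedOrder.OrderRegular 1 2 Q (DistributedOrder.H₂ ρ₂ U) →
      ∀ R R' Λ Λ' : ℕ, 1 ≤ R → 1 ≤ R' → 1 ≤ Λ → 1 ≤ Λ' →
      ∀ α ∈ Set.Ioo (0 : ℝ) 1, ∀ β ∈ Set.Ioo (1 : ℝ) 2,
        DistributedOrder.l2Norm (DistributedOrder.residual ρ₁ ρ₂ κ f U P Q R R' Λ Λ') ≤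
          DistributedOrder.orderConst 0 1 P (DistributedOrder.H₁ ρ₁ U) * Real.pi / 4 ^ P
          + |κ| * DistributedOrder.orderConst 1 2 Q (DistributedOrder.H₂ ρ₂ U) * Real.pi / 4 ^ Q
          + 3 * max (max B B₀) (max B₁ B₂) *
            (P * DistributedOrder.maxWeight 0 1 P * DistributedOrder.maxAtNodes 0 1 P ρ₁
                / Real.Gamma (2 - α)
              + 1
              + |κ| * (2 * Q * DistributedOrder.maxWeight 1 2 Q
                  * DistributedOrder.maxAtNodes 1 2 Q ρ₂ / Real.Gamma (3 - β))
              + 3)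
            * √(DistributedOrder.tailSum R R' Λ Λ')) ∧
    -- the tail sum vanishes as the number of basis functions grows
    Tendsto (fun n : ℕ × ℕ × ℕ × ℕ => DistributedOrder.tailSum n.1 n.2.1 n.2.2.1 n.2.2.2)
      atTop (𝓝 0) ∧
    -- the residual vanishes as the numbers of basis functions and of quadrature nodes grow
    ((∀ P : ℕ, 1 ≤ P → DistributedOrder.OrderRegular 0 1 P (DistributedOrder.H₁ ρ₁ U)) →
      (∀ Q : ℕ, 1 ≤ Q → DistributedOrder.OrderRegular 1 2 Q (DistributedOrder.H₂ ρ₂ U)) →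
      ∀ ε : ℝ, 0 < ε → ∃ N : ℕ, ∀ P Q R R' Λ Λ' : ℕ,
        N ≤ P → N ≤ Q → N ≤ R → N ≤ R' → N ≤ Λ → N ≤ Λ' →
          DistributedOrder.l2Norm (DistributedOrder.residual ρ₁ ρ₂ κ f U P Q R R' Λ Λ') < ε) := by
  refine ⟨fun P Q hP hQ hH₁ hH₂ R R' Λ Λ' hR hR' _ _ α hα β hβ => ?_, tendsto_tailSum,
    fun hH₁ hH₂ ε hε => ?_⟩
  · rw [residual_eq_trunc hU.continuousOn hUt.continuousOn hUxx.continuousOn hf.continuousOn]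
    have hE := (l2Norm_trunc_le (squareContinuous_discretizedOperator (ρ₁ := ρ₁) (ρ₂ := ρ₂)
      (κ := κ) hU.continuousOn hUt.continuousOn hUxx.continuousOn hf.continuousOn P Q) hR hR'
        Λ Λ').trans (sqrt_integral_sq_le fun x hx t ht =>
          abs_discretizedOperator_le hsol hP hQ le_rfl le_rfl hH₁ hH₂ hx ht)
    have hpi : (2 : ℝ) ≤ Real.pi := Real.two_le_pi
    have h1 : 2 * orderConst 0 1 P (H₁ ρ₁ U) / 4 ^ P ≤
        orderConst 0 1 P (H₁ ρ₁ U) * Real.pi / 4 ^ P := by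
      have := orderConst_nonneg 0 1 P (H₁ ρ₁ U)
      rw [mul_comm 2]
      gcongr
    have h2 : |κ| * (2 * orderConst 1 2 Q (H₂ ρ₂ U) / 4 ^ Q) ≤
        |κ| * orderConst 1 2 Q (H₂ ρ₂ U) * Real.pi / 4 ^ Q := by
      rw [mul_assoc, mul_div_assoc |κ|]
      have := orderConst_nonneg 1 2 Q (H₂ ρ₂ U)
      rw [mul_comm 2]
      gcongr
    have hB : 0 ≤ max (max B B₀) (max B₁ B₂) :=
      hf.nonneg.trans ((le_max_left _ _).trans (le_max_left _ _))
    have hΓ₁ : 0 < Real.Gamma (2 - α) := Real.Gamma_pos_of_pos (by linarith [hα.2])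
    have hΓ₂ : 0 < Real.Gamma (3 - β) := Real.Gamma_pos_of_pos (by linarith [hβ.2])
    have hw₁ := maxWeight_nonneg 0 1 P
    have hw₂ := maxWeight_nonneg 1 2 Q
    have hρ₁ := maxAtNodes_nonneg 0 1 P ρ₁
    have hρ₂ := maxAtNodes_nonneg 1 2 Q ρ₂
    -- The quadrature terms already bound the residual; it remains that the wavelet term is
    -- nonnegative.
    refine hE.trans ((add_le_add h1 h2).trans (le_add_of_nonneg_right ?_))
    positivity
  · have hlim := (tendsto_integral_discretizedOperator_sq hU.continuousOn hUt.continuousOn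
      hUxx.continuousOn hf.continuousOn hsol (hH₁ 1 le_rfl) (hH₂ 1 le_rfl)).sqrt
    rw [Real.sqrt_zero] at hlim
    obtain ⟨⟨a, b⟩, hab⟩ := eventually_atTop.1 (hlim.eventually (gt_mem_nhds hε))
    -- The `1` secures `R, R' ≥ 1`, needed for orthonormality; the projection bound is uniform in
    -- the wavelet parameters, so only `P` and `Q` must be large.
    refine ⟨max 1 (max a b), fun P Q R R' Λ Λ' hP hQ hR hR' _ _ => ?_⟩
    rw [residual_eq_trunc hU.continuousOn hUt.continuousOn hUxx.continuousOn hf.continuousOn]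
    exact (l2Norm_trunc_le (squareContinuous_discretizedOperator hU.continuousOn hUt.continuousOn
      hUxx.continuousOn hf.continuousOn P Q) ((le_max_left _ _).trans hR)
        ((le_max_left _ _).trans hR') Λ Λ').trans_lt (hab (P, Q) ⟨by
          dsimp only; omega, by dsimp only; omega⟩)
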